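/- **Setting.** Fix a set $\mathcal G$ of gates named by bit strings, each gate acting on finitely many lines and being a unitary diagonal in the $X$ basis, i.e. of the form $H^{\otimes k} V H^{\otimes k}$ with $V$ a unitary diagonal in the computational basis (for instance $V\in\{Z, CZ, T\}$). An *IQP circuit* on $N$ lines is $U=H^{\otimes N}V_1\cdots V_M H^{\otimes N}$, where $V_1,\dots,V_M$ come from gates of $\mathcal G$ placed on distinct lines; the input is $|0\cdots 0\rangle$, and a designated register of lines is measured in the computational basis. A *randomized classical circuit* consists of NAND gates acting on lines that are initially $0$ or independent uniformly random bits, again with a designated measured register. A family of circuits $\{\mathcal C_w\}$ indexed by bit strings $w$ is *uniform* if a description of $\mathcal C_w$, including its designated register, can be computed from $w$ by a Turing machine in time polynomial in the length of $w$ (numbers in the description being written in unary). A language $L\subseteq\{0,1\}^*$ is in *post-IQP* (resp. *post-BPP*) if there are a constant $0<\epsilon<\frac12$ and a uniform family $\{\mathcal C_w\}$ of IQP (resp. randomized classical) circuits whose designated register consists of a single output line $\mathcal O_w$ and a disjoint post-selection register $\mathcal P_w$, such that for all $w$: $\operatorname{Prob}[\mathcal P_w=0\cdots0]\neq0$; if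 $w\in L$ then $\operatorname{Prob}[\mathcal O_w=1\mid \mathcal P_w=0\cdots0]\ge 1-\epsilon$; and if $w\notin L$ then $\operatorname{Prob}[\mathcal O_w=0\mid \mathcal P_w=0\cdots0]\ge 1-\epsilon$. A family $\{\mathcal C_w\}$ of IQP circuits with output distributions $P_w$ (the laws of the designated registers) is *weakly classically simulable with multiplicative error* $c\ge1$ if there is a uniform family of randomized classical circuits with output distributions $R_w$ such that for all $w$ and all bit strings $x$ $$\frac1c\operatorname{Prob}[P_w=x]\le\operatorname{Prob}[R_w=x]\le c\,\operatorname{Prob}[P_w=x].$$ **Theorem.** Let $1\le c<\sqrt2$. If every uniform family of IQP circuits (over $\mathcal G$) is weakly classically simulable with multiplicative error $c$, then $\text{post-IQP}\subseteq\text{post-BPP}$ (post-IQP being taken over the same $\mathcal G$). -/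

import Mathlib

namespace IQPSim

/-! ### Reading registers and post-selection

`μ` gives the probability of every joint outcome `x : ι → Bool` of measuring all lines of a
circuit whose lines are labelled by `ι`. A register is an ordered list of lines. -/

/-- The probability that the lines of the register `r` read the bit string `y`. -/
noncomputable def regProb {ι : Type} [Fintype ι] [DecidableEq ι]
    (μ : (ι → Bool) → ℝ) (r : List ι) (y : List Bool) : ℝ :=
  ∑ x : ι → Bool, if r.map x = y then μ x else 0

/-- `Prob[P = 0…0]`. -/
noncomputable def postProb {ι : Type} [Fintype ι] [DecidableEq ι]
    (μ : (ι → Bool) → ℝ) (P : List ι) : ℝ :=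
  regProb μ P (List.replicate P.length false)

/-- `Prob[O = b | P = 0…0]`, where the output register `O` is the single line `o`. -/
noncomputable def condProb {ι : Type} [Fintype ι] [DecidableEq ι]
    (μ : (ι → Bool) → ℝ) (o : ι) (P : List ι) (b : Bool) : ℝ :=
  regProb μ (o :: P) (b :: List.replicate P.length false) / postProb μ P

/-- The register `r` consists of an output line `o` followed by a post-selection register `P`,
the post-selection event has nonzero probability, and conditionally on it the line `o` shows
the answer to `w ∈ L` with error at most `ε`. -/
def PostDecides {ι : Type} [Fintype ι] [DecidableEq ι]
    (μ : (ι → Bool) → ℝ) (r : List ι) (ε : ℝ) (L : Language Bool) (w : List Bool) : Prop :=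
  ∃ (o : ι) (P : List ι), r = o :: P ∧ postProb μ P ≠ 0 ∧
    (w ∈ L → 1 - ε ≤ condProb μ o P true) ∧ (w ∉ L → 1 - ε ≤ condProb μ o P false)

/-! ### Descriptions of circuits and uniform families -/

/-- The finite alphabet in which circuits are described. -/
inductive Sym : Type
  | tick : Sym
  | sep : Sym
  | bit : Bool → Sym
  | gate : Sym
  | out : Sym

/-- Unary numerals: a circuit description is at least as long as the number of lines. -/
def encNum (n : ℕ) : List Sym := List.replicate n Sym.tick ++ [Sym.sep]

/-- A family of circuits indexed by input bit strings `w` is uniform if a Turing machine maps `w`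
to the description of the circuit for `w` in time polynomial in the length of `w`. -/
def Uniform {α : Type} (enc : α → List Sym) (C : List Bool → α) : Prop :=
  Nonempty (Turing.TM2ComputableInPolyTime (id : List Bool → List Bool) enc C)

/-! ### IQP circuits -/

/-- A set of gates, named by bit strings. The gate named `g` acts on `arity g` lines, and
`phase g` lists the diagonal entries of its conjugate `V` by Hadamard gates on these lines,
so that the gate itself is the unitary `H V H`, diagonal in the `X` basis.
Every `X`-diagonal unitary can occur; a finite gate set is the case in which all but finitely
many strings name the trivial gate. -/
structure GateSet where
  arity : List Bool → ℕ
  phase : (g : List Bool) → (Fin (arity g) → Bool) → ℂ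
  norm_phase : ∀ g z, ‖phase g z‖ = 1

/-- A gate of the gate set `G`, applied to distinct lines of a circuit with `N` lines. -/
structure PlacedGate (G : GateSet) (N : ℕ) where
  name : List Bool
  on : Fin (G.arity name) ↪ Fin N

/-- An IQP circuit over the gate set `G`, with a designated register of measured lines. -/
structure IQPCircuit (G : GateSet) where
  lines : ℕ
  gates : List (PlacedGate G lines)
  reg : List (Fin lines)
  reg_nodup : reg.Nodup

/-- The matrix of `H ⊗ ⋯ ⊗ H` in the computational basis. -/
noncomputable def hadamard (N : ℕ) : Matrix (Fin N → Bool) (Fin N → Bool) ℂ :=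
  fun x z => ∏ i, (if x i && z i then (-1 : ℂ) else 1) / (Real.sqrt 2 : ℂ)

/-- The `Z`-diagonal matrix `V` on all lines belonging to a placed gate. -/
noncomputable def PlacedGate.diag {G : GateSet} {N : ℕ} (g : PlacedGate G N) :
    Matrix (Fin N → Bool) (Fin N → Bool) ℂ :=
  Matrix.diagonal fun z => G.phase g.name fun j => z (g.on j)

namespace IQPCircuit

variable {G : GateSet}

/-- The unitary `H^{⊗N} V₁ ⋯ V_M H^{⊗N}` of the circuit. -/
noncomputable def unitary (C : IQPCircuit G) :
    Matrix (Fin C.lines → Bool) (Fin C.lines → Bool) ℂ :=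
  hadamard C.lines * (C.gates.map PlacedGate.diag).prod * hadamard C.lines

/-- Born's rule on all lines, for the input state `|0…0⟩`. -/
noncomputable def born (C : IQPCircuit G) (x : Fin C.lines → Bool) : ℝ :=
  ‖C.unitary x (fun _ => false)‖ ^ 2

/-- The output distribution: the law of the measured register. -/
noncomputable def outProb (C : IQPCircuit G) (y : List Bool) : ℝ :=
  regProb C.born C.reg y

/-- The description of an IQP circuit. -/
def encode (C : IQPCircuit G) : List Sym :=
  encNum C.lines ++
    C.gates.flatMap (fun g => Sym.gate :: g.name.map Sym.bit ++
      (List.ofFn fun j => g.on j).flatMap (fun i => encNum i)) ++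
    Sym.out :: C.reg.flatMap (fun i => encNum i)

end IQPCircuit

/-! ### Randomized classical circuits -/

/-- The lines of a classical circuit: `a` lines initialized to `0` and `r` lines initialized to
independent uniformly random bits. -/
abbrev CLine (a r : ℕ) : Type := Fin a ⊕ Fin r

/-- A NAND gate: writes `¬ (in₁ ∧ in₂)` on the line `tgt`. -/
structure NandGate (a r : ℕ) where
  in₁ : CLine a r
  in₂ : CLine a r
  tgt : CLine a r

/-- A randomized classical circuit, with a designated register of measured lines. -/
structure RandCircuit where
  aux : ℕ
  rand : ℕ
  gates : List (NandGate aux rand)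
  reg : List (CLine aux rand)
  reg_nodup : reg.Nodup

/-- The effect of a gate on the values of all lines. -/
def NandGate.apply {a r : ℕ} (s : CLine a r → Bool) (g : NandGate a r) : CLine a r → Bool :=
  Function.update s g.tgt (!(s g.in₁ && s g.in₂))

def encLine {a r : ℕ} : CLine a r → List Sym
  | Sum.inl i => Sym.bit false :: encNum i
  | Sum.inr i => Sym.bit true :: encNum i

namespace RandCircuit

/-- The final values of all lines, when the random bits are `ρ`. -/
def eval (R : RandCircuit) (ρ : Fin R.rand → Bool) : CLine R.aux R.rand → Bool :=
  R.gates.foldl NandGate.apply (Sum.elim (fun _ => false) ρ)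

/-- The law of the final values of all lines, for uniformly random `ρ`. -/
noncomputable def law (R : RandCircuit) (x : CLine R.aux R.rand → Bool) : ℝ :=
  ((Finset.univ.filter fun ρ => R.eval ρ = x).card : ℝ) / 2 ^ R.rand

/-- The output distribution: the law of the measured register. -/
noncomputable def outProb (R : RandCircuit) (y : List Bool) : ℝ :=
  regProb R.law R.reg y

/-- The description of a randomized classical circuit. -/
def encode (R : RandCircuit) : List Sym :=
  encNum R.aux ++ encNum R.rand ++
    R.gates.flatMap (fun g => Sym.gate :: encLine g.in₁ ++ encLine g.in₂ ++ encLine g.tgt) ++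
    Sym.out :: R.reg.flatMap encLine

end RandCircuit

/-! ### Complexity classes and weak simulation -/

/-- The class post-IQP, over the gate set `G`. -/
def PostIQP (G : GateSet) : Set (Language Bool) :=
  {L | ∃ ε : ℝ, 0 < ε ∧ ε < 1 / 2 ∧ ∃ C : List Bool → IQPCircuit G,
    Uniform IQPCircuit.encode C ∧ ∀ w, PostDecides (C w).born (C w).reg ε L w}

/-- The class post-BPP. -/
def PostBPP : Set (Language Bool) :=
  {L | ∃ ε : ℝ, 0 < ε ∧ ε < 1 / 2 ∧ ∃ R : List Bool → RandCircuit,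
    Uniform RandCircuit.encode R ∧ ∀ w, PostDecides (R w).law (R w).reg ε L w}

/-- The family `C` of IQP circuits is weakly simulable with multiplicative error `c`:
a uniform (hence polynomial-size) family of randomized classical circuits samples from
distributions that agree with the output distributions of `C` up to the factor `c`. The
inequalities, for all bit strings `y`, force both registers to have the same length. -/
def WeaklySimulable {G : GateSet} (c : ℝ) (C : List Bool → IQPCircuit G) : Prop :=
  ∃ R : List Bool → RandCircuit, Uniform RandCircuit.encode R ∧
    ∀ w y, 1 / c * (C w).outProb y ≤ (R w).outProb y ∧
      (R w).outProb y ≤ c * (C w).outProb y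

end IQPSim

/-! Write `p b` for the joint probability that the output line shows `b` and the post-selection
register shows zeros. Deciding `L` with conditional error at most `ε` bounds the odds of the wrong
answer against the right one by `ε / (1 - ε) < 1`. In `K` independent copies, the event that every
copy shows `b` and zeros has probability `p b ^ K` (`IQPCircuit.outProb_copies`), so unanimity
shrinks the odds to at most `(ε / (1 - ε)) ^ K`. These copies again form an IQP circuit, so they
have a classical simulator, which costs a factor `c` on each of the two unanimous events, hence at
most `c ^ 2` on the odds. Choosing `K` with `c ^ 2 * (ε / (1 - ε)) ^ K ≤ 1 / 2` leaves a conditional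
error of at most `1 / 3` (`two_thirds_le_div`). The vote is taken after the simulation: NAND gates
compare the simulated output lines, and post-selection demands that they agree
(`RandCircuit.regProb_unanimous`). Multiplicative error is essential here, since the post-selected
events may be exponentially rare.

The rest of the work is uniformity. Both circuit transformations must act on descriptions in
polynomial time. Since `K` does not depend on the input, each new description is a concatenation of
outputs of a fixed finite list of finite-state transducers, all reading the old description
(`IQPCircuit.encode_copies`, `RandCircuit.encode_unanimous`). Polynomial-time computability survives
such post-processing: an explicit stack machine runs the original one and then sweeps back and forth
over its output (`computableInPolyTime_sweep`). The numbering of lines and the order of registers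
are chosen to make finite memory suffice. -/

namespace IQPSim

/-! ### Finite-state transducers -/

/-- A finite-state transducer: it writes `pre`, and then `out q a` for every letter `a` that it
reads in the state `q`. -/
structure Transducer (β γ : Type) where
  Q : Type
  [fin : Fintype Q]
  pre : List γ
  init : Q
  step : Q → β → Q
  out : Q → β → List γ

namespace Transducer

variable {β γ : Type}

instance (T : Transducer β γ) : Fintype T.Q := T.fin

def runFrom (T : Transducer β γ) : T.Q → List β → List γ
  | _, [] => []
  | q, a :: l => T.out q a ++ T.runFrom (T.step q a) l

def run (T : Transducer β γ) (l : List β) : List γ :=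
  T.pre ++ T.runFrom T.init l

theorem exists_length_run_le [Fintype β] (T : Transducer β γ) :
    ∃ c, ∀ l, (T.run l).length ≤ c * (l.length + 1) := by
  classical
  refine ⟨T.pre.length + ∑ q, ∑ a, (T.out q a).length, fun l => ?_⟩
  have hq : ∀ q a, (T.out q a).length ≤ ∑ q, ∑ a, (T.out q a).length := fun q a =>
    (Finset.single_le_sum (f := fun a => (T.out q a).length) (fun _ _ => Nat.zero_le _)
      (Finset.mem_univ a)).trans
    (Finset.single_le_sum (f := fun q => ∑ a, (T.out q a).length) (fun _ _ => Nat.zero_le _)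
      (Finset.mem_univ q))
  generalize ∑ q, ∑ a, (T.out q a).length = s at hq ⊢
  have h : ∀ l q, (T.runFrom q l).length ≤ s * l.length := by
    intro l
    induction l with
    | nil => simp [runFrom]
    | cons a l ih =>
      intro q
      have h1 := hq q a
      have h2 := ih (T.step q a)
      simp only [runFrom, List.length_append, List.length_cons]
      nlinarith
  have := h l T.init
  simp only [run, List.length_append]
  nlinarith

/-- The concatenated outputs of finitely many transducers, run one after the other over the same
word. -/
def sweep (L : List (Transducer β γ)) (l : List β) : List γ :=
  L.flatMap fun T => T.run l

theorem exists_length_sweep_le [Fintype β] (L : List (Transducer β γ)) :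
    ∃ c, ∀ l, (sweep L l).length ≤ c * (l.length + 1) := by
  induction L with
  | nil => exact ⟨0, by simp [sweep]⟩
  | cons T L ih =>
    obtain ⟨c, hc⟩ := ih
    obtain ⟨d, hd⟩ := T.exists_length_run_le
    refine ⟨d + c, fun l => ?_⟩
    have h1 := hc l
    have h2 := hd l
    simp only [sweep, List.flatMap_cons, List.length_append] at h1 ⊢
    nlinarith

end Transducer

/-! ### Counting steps -/

/-- `n` steps of `f` lead from `a` to `b`. -/
def StepsTo {σ : Type*} (f : σ → Option σ) (n : ℕ) (a b : σ) : Prop :=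
  (flip bind f)^[n] (some a) = some b

namespace StepsTo

variable {σ : Type*} {f : σ → Option σ} {m n : ℕ} {a b c : σ}

theorem refl (a : σ) : StepsTo f 0 a a := rfl

theorem head (h : f a = some b) (hb : StepsTo f n b c) : StepsTo f (n + 1) a c := by
  have : flip bind f (some a) = some b := h
  rw [StepsTo, Function.iterate_succ_apply, this]
  exact hb

theorem trans (h₁ : StepsTo f m a b) (h₂ : StepsTo f n b c) : StepsTo f (m + n) a c := by
  rw [StepsTo, Nat.add_comm, Function.iterate_add_apply, h₁]
  exact h₂

theorem iterate_none (f : σ → Option σ) (n : ℕ) : (flip bind f)^[n] none = none := by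
  induction n with
  | zero => rfl
  | succ n ih => rw [Function.iterate_succ_apply]; exact ih

theorem exists_of_succ (h : StepsTo f (n + 1) a c) : ∃ b, f a = some b ∧ StepsTo f n b c := by
  rw [StepsTo, Function.iterate_succ_apply] at h
  have e : flip bind f (some a) = f a := rfl
  rw [e] at h
  cases hb : f a with
  | none => rw [hb, iterate_none] at h; cases h
  | some b => rw [hb] at h; exact ⟨b, rfl, h⟩

end StepsTo

/-! ### Stack machines followed by transducers -/

section Machine

open Turing TM2.Stmt

/-- The number of push instructions of a statement. -/
def pushCount {K : Type} {Γ : K → Type} {Λ σ : Type} : TM2.Stmt Γ Λ σ → ℕ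
  | push _ _ s => pushCount s + 1
  | peek _ _ s => pushCount s
  | pop _ _ s => pushCount s
  | load _ s => pushCount s
  | branch _ s t => pushCount s + pushCount t
  | goto _ => 0
  | halt => 0

theorem length_stepAux_le {K : Type} [DecidableEq K] {Γ : K → Type} {Λ σ : Type}
    (s : TM2.Stmt Γ Λ σ) (v : σ) (S : ∀ k, List (Γ k)) (k : K) :
    ((TM2.stepAux s v S).stk k).length ≤ (S k).length + pushCount s := by
  induction s generalizing v S with
  | push j f s ih =>
    refine (ih _ _).trans ?_
    by_cases h : k = j
    · subst h; simp only [pushCount, Function.update_self, List.length_cons]; omega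
    · simp only [pushCount, Function.update_of_ne h]; omega
  | peek j f s ih => exact ih _ _
  | pop j f s ih =>
    refine (ih _ _).trans ?_
    by_cases h : k = j
    · subst h; simp [pushCount]
    · simp [pushCount, h]
  | load f s ih => exact ih _ _
  | branch f s t ih₁ ih₂ =>
    simp only [TM2.stepAux, pushCount]
    cases f v
    · exact (ih₂ _ _).trans (by omega)
    · exact (ih₁ _ _).trans (by omega)
  | goto f => simp [pushCount]
  | halt => simp [pushCount]

/-- Push the letters of a word, the last one ending up on top. -/
def pushList {K : Type} {Γ : K → Type} {Λ σ : Type} (k : K) :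
    List (Γ k) → TM2.Stmt Γ Λ σ → TM2.Stmt Γ Λ σ
  | [], s => s
  | a :: l, s => push k (fun _ => a) (pushList k l s)

theorem stepAux_pushList {K : Type} [DecidableEq K] {Γ : K → Type} {Λ σ : Type} (k : K)
    (l : List (Γ k)) (s : TM2.Stmt Γ Λ σ) (v : σ) (S : ∀ k, List (Γ k)) :
    TM2.stepAux (pushList k l s) v S =
      TM2.stepAux s v (Function.update S k (l.reverse ++ S k)) := by
  induction l generalizing S with
  | nil => simp [pushList]
  | cons a l ih => simp [pushList, ih]

theorem exists_pushCount_le (M : FinTM2) : ∃ B, ∀ l, pushCount (M.m l) ≤ B := by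
  classical
  let _ := M.ΛFin
  exact ⟨∑ l, pushCount (M.m l), fun l =>
    Finset.single_le_sum (f := fun l => pushCount (M.m l)) (fun _ _ => Nat.zero_le _)
      (Finset.mem_univ l)⟩

/-- Running time bounds output length, and so bounds the word over which the transducers sweep
afterwards. One step executes a whole statement and may push several letters, whence the factor `B`.
-/
theorem StepsTo.length_stk_le {M : FinTM2} {B : ℕ} (hB : ∀ l, pushCount (M.m l) ≤ B) {n : ℕ}
    {a b : M.Cfg} (h : StepsTo M.step n a b) (k : M.K) :
    (b.stk k).length ≤ (a.stk k).length + B * n := by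
  induction n generalizing a with
  | zero => cases h; simp
  | succ n ih =>
    obtain ⟨c, hc, h⟩ := h.exists_of_succ
    have h1 := ih h
    have h2 : (c.stk k).length ≤ (a.stk k).length + B := by
      rcases a with ⟨_ | l, v, S⟩
      · cases hc
      · obtain rfl : TM2.stepAux (M.m l) v S = c := Option.some.inj hc
        exact (length_stepAux_le _ _ _ _).trans (Nat.add_le_add_left (hB l) _)
    rw [Nat.mul_add]
    omega

/-- The additional stacks of `sweepMachine`. -/
inductive ExtraStack
  | hold : ExtraStack
  | rev : ExtraStack
  | res : ExtraStack
  deriving DecidableEq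

instance : Fintype ExtraStack :=
  ⟨{.hold, .rev, .res}, fun x => by cases x <;> simp⟩

/-- The labels of `sweepMachine`. -/
inductive SweepLabel (Λ P S β γ : Type)
  | sim : Λ → SweepLabel Λ P S β γ
  | start : P → SweepLabel Λ P S β γ
  | fwd : S → SweepLabel Λ P S β γ
  | emit : S → β → SweepLabel Λ P S β γ
  | back : P → SweepLabel Λ P S β γ
  | put : P → β → SweepLabel Λ P S β γ
  | clear : SweepLabel Λ P S β γ
  | flush : SweepLabel Λ P S β γ
  | write : γ → SweepLabel Λ P S β γ
  deriving Fintype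

variable {β γ : Type}

abbrev sweepΓ (M : FinTM2) (β γ : Type) : M.K ⊕ ExtraStack → Type
  | Sum.inl k => M.Γ k
  | Sum.inr ExtraStack.hold => β
  | Sum.inr ExtraStack.rev => γ
  | Sum.inr ExtraStack.res => γ

/-- The states of the transducers of a list. -/
abbrev SweepState (L : List (Transducer β γ)) : Type :=
  Σ p : Fin L.length, (L[p]).Q

abbrev SweepLab (M : FinTM2) (L : List (Transducer β γ)) : Type :=
  SweepLabel M.Λ (Fin L.length) (SweepState L) β γ

abbrev SweepStmt (M : FinTM2) (L : List (Transducer β γ)) : Type :=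
  TM2.Stmt (sweepΓ M β γ) (SweepLab M L) (M.σ × Option β × Option γ)

/-- The label at which the transducer number `k` of the list starts. -/
def startLabel (M : FinTM2) (L : List (Transducer β γ)) (k : ℕ) : SweepLab M L :=
  if h : k < L.length then SweepLabel.start ⟨k, h⟩ else SweepLabel.clear

/-- The statements of `M` as statements of `sweepMachine`. -/
def liftStmt (M : FinTM2) (L : List (Transducer β γ)) :
    TM2.Stmt M.Γ M.Λ M.σ → SweepStmt M L
  | push k f s => push (Sum.inl k) (fun v => f v.1) (liftStmt M L s)
  | peek k f s => peek (Sum.inl k) (fun v a => (f v.1 a, v.2)) (liftStmt M L s)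
  | pop k f s => pop (Sum.inl k) (fun v a => (f v.1 a, v.2)) (liftStmt M L s)
  | load f s => load (fun v => (f v.1, v.2)) (liftStmt M L s)
  | branch f s t => branch (fun v => f v.1) (liftStmt M L s) (liftStmt M L t)
  | goto f => goto fun v => SweepLabel.sim (f v.1)
  | halt => goto fun _ => startLabel M L 0

/-- The program of `sweepMachine`. -/
def sweepProgram (M : FinTM2) (e : M.Γ M.k₁ ≃ β) (L : List (Transducer β γ)) :
    SweepLab M L → SweepStmt M L
  | SweepLabel.sim l => liftStmt M L (M.m l)
  | SweepLabel.start p =>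
      pushList (Γ := sweepΓ M β γ) (Sum.inr ExtraStack.rev) (L[p]).pre <|
      goto fun _ => SweepLabel.fwd ⟨p, (L[p]).init⟩
  | SweepLabel.fwd s =>
      pop (Sum.inl M.k₁) (fun v a => (v.1, a.map e, none)) <|
      -- The letter read moves from the state into the label, so that the words pushed at the next
      -- label are constants.
      goto fun v => match v.2.1 with
        | none => SweepLabel.back s.1
        | some a => SweepLabel.emit s a
  | SweepLabel.emit s a =>
      push (Sum.inr ExtraStack.hold) (fun _ => a) <|
      pushList (Γ := sweepΓ M β γ) (Sum.inr ExtraStack.rev) ((L[s.1]).out s.2 a) <|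
      goto fun _ => SweepLabel.fwd ⟨s.1, (L[s.1]).step s.2 a⟩
  | SweepLabel.back p =>
      pop (Sum.inr ExtraStack.hold) (fun v a => (v.1, a, none)) <|
      goto fun v => match v.2.1 with
        | none => startLabel M L (p + 1)
        | some a => SweepLabel.put p a
  | SweepLabel.put p a =>
      push (Sum.inl M.k₁) (fun _ => e.symm a) <|
      goto fun _ => SweepLabel.back p
  | SweepLabel.clear =>
      pop (Sum.inl M.k₁) (fun v a => (v.1, a.map e, none)) <|
      goto fun v => match v.2.1 with
        | none => SweepLabel.flush
        | some _ => SweepLabel.clear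
  | SweepLabel.flush =>
      pop (Sum.inr ExtraStack.rev) (fun v a => (v.1, none, a)) <|
      -- The only exit to `halt`. On the empty stack the preceding pop has reset both letter
      -- components to `none`, the initial state that a halting configuration must have.
      branch (fun v => v.2.2.isSome)
        (goto fun v => match v.2.2 with
          | none => SweepLabel.flush
          | some a => SweepLabel.write a)
        halt
  | SweepLabel.write a =>
      push (Sum.inr ExtraStack.res) (fun _ => a) <|
      goto fun _ => SweepLabel.flush

/-- The machine that runs `M`, then runs the transducers of the list `L` one after the other over
the output of `M`, and outputs the concatenation of what they write. -/
def sweepMachine [Fintype β] [Fintype γ] (M : FinTM2) (e : M.Γ M.k₁ ≃ β)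
    (L : List (Transducer β γ)) : FinTM2 :=
  letI := M.kFin
  letI := M.ΛFin
  letI := M.σFin
  letI := M.Γk₀Fin
  { K := M.K ⊕ ExtraStack
    k₀ := Sum.inl M.k₀
    k₁ := Sum.inr ExtraStack.res
    Γ := sweepΓ M β γ
    Λ := SweepLab M L
    main := SweepLabel.sim M.main
    σ := M.σ × Option β × Option γ
    initialState := (M.initialState, none, none)
    Γk₀Fin := M.Γk₀Fin
    m := sweepProgram M e L }

theorem haltList_stk_self (M : FinTM2) (l : List (M.Γ M.k₁)) : (haltList M l).stk M.k₁ = l := by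
  simp [haltList]

/-- The stacks of `sweepMachine` when all stacks of `M` except for its output stack are empty. -/
def sweepStk (M : FinTM2) (e : M.Γ M.k₁ ≃ β) (x h : List β) (r y : List γ) :
    ∀ k, List (sweepΓ M β γ k)
  | Sum.inl k => (haltList M (x.map e.symm)).stk k
  | Sum.inr ExtraStack.hold => h
  | Sum.inr ExtraStack.rev => r
  | Sum.inr ExtraStack.res => y

section sweepStk

variable (M : FinTM2) (e : M.Γ M.k₁ ≃ β) (x h : List β) (r y : List γ)

theorem sweepStk_input : sweepStk M e x h r y (Sum.inl M.k₁) = x.map e.symm :=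
  haltList_stk_self M _

theorem update_sweepStk_input (x' : List β) :
    Function.update (sweepStk M e x h r y) (Sum.inl M.k₁) (x'.map e.symm) =
      sweepStk M e x' h r y := by
  funext k
  rcases k with k | k | k | k
  · by_cases hk : k = M.k₁
    · subst hk; simp [sweepStk, haltList]
    · simp [sweepStk, haltList, hk]
  all_goals simp [sweepStk]

theorem update_sweepStk_hold (h' : List β) :
    Function.update (sweepStk M e x h r y) (Sum.inr ExtraStack.hold) h' =
      sweepStk M e x h' r y := by
  funext k
  rcases k with k | k | k | k <;> simp [sweepStk]

theorem update_sweepStk_rev (r' : List γ) :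
    Function.update (sweepStk M e x h r y) (Sum.inr ExtraStack.rev) r' =
      sweepStk M e x h r' y := by
  funext k
  rcases k with k | k | k | k <;> simp [sweepStk]

theorem update_sweepStk_res (y' : List γ) :
    Function.update (sweepStk M e x h r y) (Sum.inr ExtraStack.res) y' =
      sweepStk M e x h r y' := by
  funext k
  rcases k with k | k | k | k <;> simp [sweepStk]

end sweepStk

abbrev SweepCfg (M : FinTM2) (L : List (Transducer β γ)) : Type :=
  TM2.Cfg (sweepΓ M β γ) (SweepLab M L) (M.σ × Option β × Option γ)

/-- The configurations of `sweepMachine` while it runs `M`. -/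
def liftCfg (M : FinTM2) (L : List (Transducer β γ)) (c : M.Cfg) : SweepCfg M L where
  l := some (c.l.elim (startLabel M L 0) SweepLabel.sim)
  var := (c.var, none, none)
  stk
    | Sum.inl k => c.stk k
    | Sum.inr ExtraStack.hold => []
    | Sum.inr ExtraStack.rev => []
    | Sum.inr ExtraStack.res => []

/-- Lifted statements touch only the stacks and the state component of `M`. The one change is at
`halt`, which becomes a jump to the first transducer, just as `liftCfg` translates the absent label.
The label `l` is arbitrary because `stepAux` does not look at it. -/
theorem stepAux_liftStmt (M : FinTM2) (L : List (Transducer β γ)) (s : TM2.Stmt M.Γ M.Λ M.σ)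
    (l : Option M.Λ) (v : M.σ) (S : ∀ k, List (M.Γ k)) :
    TM2.stepAux (liftStmt M L s) (liftCfg M L ⟨l, v, S⟩).var (liftCfg M L ⟨l, v, S⟩).stk =
      liftCfg M L (TM2.stepAux s v S) := by
  have key : ∀ (S : ∀ k, List (M.Γ k)) (l : Option M.Λ) (v w : M.σ) (k : M.K) (t : List (M.Γ k)),
      Function.update (liftCfg M L ⟨l, v, S⟩).stk (Sum.inl k) t =
        (liftCfg M L ⟨l, w, Function.update S k t⟩).stk := by
    intro S l v w k t
    funext j
    rcases j with j | j | j | j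
    · by_cases hj : j = k
      · subst hj; simp [liftCfg]
      · simp [liftCfg, hj]
    all_goals simp [liftCfg]
  induction s generalizing v S with
  | push k f s ih =>
    have := key S l v v k (f v :: S k)
    simp only [liftStmt, TM2.stepAux]
    rw [← ih, ← this]
    rfl
  | peek k f s ih => exact ih _ _
  | pop k f s ih =>
    have := key S l v (f v (S k).head?) k (S k).tail
    simp only [liftStmt, TM2.stepAux]
    rw [← ih, ← this]
    rfl
  | load f s ih => exact ih _ _
  | branch f s t ih₁ ih₂ =>
    simp only [liftStmt, TM2.stepAux]
    change cond (f v) _ _ = liftCfg M L (cond (f v) _ _)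
    cases f v
    · exact ih₂ v S
    · exact ih₁ v S
  | goto f => rfl
  | halt => rfl

/-! ### Exact step counts for the phases of the sweeping machine -/

variable (M : FinTM2) (e : M.Γ M.k₁ ≃ β) (L : List (Transducer β γ))

theorem stepsTo_liftCfg {n : ℕ} {a b : M.Cfg} (h : StepsTo M.step n a b) :
    StepsTo (TM2.step (sweepProgram M e L)) n (liftCfg M L a) (liftCfg M L b) := by
  induction n generalizing a with
  | zero => cases h; rfl
  | succ n ih =>
    obtain ⟨c, hc, h⟩ := h.exists_of_succ
    refine StepsTo.head ?_ (ih h)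
    rcases a with ⟨_ | l, v, S⟩
    · cases hc
    · obtain rfl : TM2.stepAux (M.m l) v S = c := Option.some.inj hc
      exact congrArg some (stepAux_liftStmt M L (M.m l) (some l) v S)

/-- A configuration of `sweepMachine` after `M` has halted. -/
def sweepCfg (l : SweepLab M L) (a : Option β) (b : Option γ) (x h : List β) (r y : List γ) :
    SweepCfg M L :=
  ⟨some l, (M.initialState, a, b), sweepStk M e x h r y⟩

theorem liftCfg_haltList (x : List β) :
    liftCfg M L (haltList M (x.map e.symm)) =
      sweepCfg M e L (startLabel M L 0) none none x [] [] [] := by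
  unfold liftCfg sweepCfg
  congr 1

theorem liftCfg_initList [Fintype β] [Fintype γ] (x : List (M.Γ M.k₀)) :
    liftCfg M L (initList M x) = initList (sweepMachine M e L) x := by
  unfold liftCfg initList
  congr 1
  funext k
  rcases k with k | k | k | k
  · by_cases hk : k = M.k₀
    · subst hk; simp [sweepMachine]; rfl
    · simp [sweepMachine, hk]
  all_goals simp [sweepMachine]

theorem haltList_sweepMachine [Fintype β] [Fintype γ] (y : List γ) :
    (⟨none, (M.initialState, none, none), sweepStk M e [] [] [] y⟩ : SweepCfg M L) =
      haltList (sweepMachine M e L) y := by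
  unfold haltList
  congr 1
  funext k
  rcases k with k | k | k | k
  · have h : (haltList M []).stk k = [] := by
      by_cases hk : k = M.k₁
      · subst hk; exact haltList_stk_self M []
      · simp [haltList, hk]
    simpa [sweepMachine, sweepStk] using h
  · simp [sweepMachine, sweepStk]
  · simp [sweepMachine, sweepStk]
  · simp [sweepMachine, sweepStk]; rfl

variable (a : Option β) (b : Option γ) (x h : List β) (r y : List γ)

local notation "Steps" => StepsTo (TM2.step (sweepProgram M e L))

/-- Each letter costs one pop and one step of pushes, and one more step detects the empty stack. The
word is saved in reverse on `hold`, while the output accumulates in reverse on `rev`. -/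
theorem steps_forward (s : SweepState L) :
    ∃ h', h' = x.reverse ++ h ∧ Steps (2 * x.length + 1)
      (sweepCfg M e L (SweepLabel.fwd s) a b x h r y)
      (sweepCfg M e L (SweepLabel.back s.1) none none [] h'
        (((L[s.1]).runFrom s.2 x).reverse ++ r) y) := by
  refine ⟨_, rfl, ?_⟩
  induction x generalizing s h r a b with
  | nil =>
    refine StepsTo.head ?_ (StepsTo.refl _)
    simp only [sweepCfg, TM2.step, sweepProgram, TM2.stepAux, sweepStk_input]
    have := update_sweepStk_input M e [] h r y []
    simp only [List.map_nil, List.tail_nil, List.head?_nil, Option.map_none] at this ⊢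
    rw [this]
    rfl
  | cons c x ih =>
    rw [List.length_cons, Nat.mul_succ, Nat.add_right_comm]
    refine StepsTo.head (b := sweepCfg M e L (SweepLabel.emit s c) (some c) none x h r y) ?_
      (StepsTo.head (b := sweepCfg M e L (SweepLabel.fwd ⟨s.1, (L[s.1]).step s.2 c⟩) (some c) none x
        (c :: h) ((L[s.1].out s.2 c).reverse ++ r) y) ?_ ?_)
    rotate_left 2
    · simpa [Transducer.runFrom] using ih (some c) none (c :: h) ((L[s.1].out s.2 c).reverse ++ r)
        ⟨s.1, (L[s.1]).step s.2 c⟩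
    · simp only [sweepCfg, TM2.step, sweepProgram, TM2.stepAux, sweepStk_input]
      have := update_sweepStk_input M e (c :: x) h r y x
      simp only [List.map_cons, List.tail_cons, List.head?_cons, Option.map_some,
        Equiv.apply_symm_apply] at this ⊢
      rw [this]
    · simp only [sweepCfg, TM2.step, sweepProgram, TM2.stepAux]
      rw [update_sweepStk_hold, stepAux_pushList, update_sweepStk_rev]
      rfl

theorem steps_back (p : Fin L.length) :
    Steps (2 * h.length + 1)
      (sweepCfg M e L (SweepLabel.back p) a b x h r y)
      (sweepCfg M e L (startLabel M L (p + 1)) none none (h.reverse ++ x) [] r y) := by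
  induction h generalizing x a b with
  | nil =>
    refine StepsTo.head ?_ (StepsTo.refl _)
    simp only [sweepCfg, TM2.step, sweepProgram, TM2.stepAux]
    rw [update_sweepStk_hold]
    rfl
  | cons c h ih =>
    rw [List.length_cons, Nat.mul_succ, Nat.add_right_comm]
    refine StepsTo.head (b := sweepCfg M e L (SweepLabel.put p c) (some c) none x h r y) ?_
      (StepsTo.head (b := sweepCfg M e L (SweepLabel.back p) (some c) none (c :: x) h r y) ?_ ?_)
    rotate_left 2
    · simpa using ih (some c) none (c :: x)
    · simp only [sweepCfg, TM2.step, sweepProgram, TM2.stepAux]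
      rw [update_sweepStk_hold]
      rfl
    · simp only [sweepCfg, TM2.step, sweepProgram, TM2.stepAux, sweepStk_input]
      rw [← List.map_cons, update_sweepStk_input]

/-- The backward pass undoes the reversal on `hold`, so the next transducer finds the same word.
Since `rev` is not emptied in between, successive outputs concatenate and a single final flush
reverses them all. -/
theorem steps_transducer (p : Fin L.length) :
    Steps (4 * x.length + 3)
      (sweepCfg M e L (SweepLabel.start p) a b x [] r y)
      (sweepCfg M e L (startLabel M L (p + 1)) none none x []
        (((L[p]).run x).reverse ++ r) y) := by
  have h₁ : Steps 1 (sweepCfg M e L (SweepLabel.start p) a b x [] r y)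
      (sweepCfg M e L (SweepLabel.fwd ⟨p, (L[p]).init⟩) a b x []
        ((L[p]).pre.reverse ++ r) y) := by
    refine StepsTo.head ?_ (StepsTo.refl _)
    simp only [sweepCfg, TM2.step, sweepProgram]
    rw [stepAux_pushList, update_sweepStk_rev]
    rfl
  obtain ⟨h', rfl, h₂⟩ := steps_forward M e L a b x [] ((L[p]).pre.reverse ++ r) y
    ⟨p, (L[p]).init⟩
  have h₃ := steps_back M e L none none [] (x.reverse ++ [])
    (((L[p]).runFrom (L[p]).init x).reverse ++ ((L[p]).pre.reverse ++ r)) y p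
  have := (h₁.trans h₂).trans h₃
  have ht : 1 + (2 * x.length + 1) + (2 * (x.reverse ++ []).length + 1) = 4 * x.length + 3 := by
    simp; omega
  rw [ht] at this
  simpa [Transducer.run] using this

theorem steps_sweep_drop (k : ℕ) (hk : k ≤ L.length) :
    Steps ((L.length - k) * (4 * x.length + 3))
      (sweepCfg M e L (startLabel M L k) none none x [] r y)
      (sweepCfg M e L SweepLabel.clear none none x []
        ((Transducer.sweep (L.drop k) x).reverse ++ r) y) := by
  obtain ⟨d, hd⟩ : ∃ d, d = L.length - k := ⟨_, rfl⟩
  induction d generalizing k r with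
  | zero =>
    obtain rfl : k = L.length := by omega
    simp only [Nat.sub_self, Nat.zero_mul]
    simp [startLabel, Transducer.sweep, StepsTo]
  | succ d ih =>
    have hlt : k < L.length := by omega
    have h₁ := steps_transducer M e L none none x r y ⟨k, hlt⟩
    have h₂ := ih (((L[k]).run x).reverse ++ r) (k + 1) hlt (by omega)
    have := h₁.trans h₂
    have ht : 4 * x.length + 3 + (L.length - (k + 1)) * (4 * x.length + 3) =
        (L.length - k) * (4 * x.length + 3) := by
      rw [show L.length - k = (L.length - (k + 1)) + 1 by omega]; ring
    rw [ht] at this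
    rw [List.drop_eq_getElem_cons hlt, Transducer.sweep, List.flatMap_cons, List.reverse_append,
      List.append_assoc]
    unfold startLabel
    rw [dif_pos hlt]
    exact this

theorem steps_clear :
    Steps (x.length + 1)
      (sweepCfg M e L SweepLabel.clear a b x h r y)
      (sweepCfg M e L SweepLabel.flush none none [] h r y) := by
  induction x generalizing a b with
  | nil =>
    refine StepsTo.head ?_ (StepsTo.refl _)
    simp only [sweepCfg, TM2.step, sweepProgram, TM2.stepAux, sweepStk_input]
    have := update_sweepStk_input M e [] h r y []
    simp only [List.map_nil, List.tail_nil, List.head?_nil, Option.map_none] at this ⊢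
    rw [this]
  | cons c x ih =>
    refine StepsTo.head ?_ (ih (some c) none)
    simp only [sweepCfg, TM2.step, sweepProgram, TM2.stepAux, sweepStk_input]
    have := update_sweepStk_input M e (c :: x) h r y x
    simp only [List.map_cons, List.tail_cons, List.head?_cons, Option.map_some,
      Equiv.apply_symm_apply] at this ⊢
    rw [this]

theorem steps_flush :
    Steps (2 * r.length + 1)
      (sweepCfg M e L SweepLabel.flush a b x h r y)
      ⟨none, (M.initialState, none, none), sweepStk M e x h [] (r.reverse ++ y)⟩ := by
  induction r generalizing a b y with
  | nil =>
    refine StepsTo.head ?_ (StepsTo.refl _)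
    simp only [sweepCfg, TM2.step, sweepProgram, TM2.stepAux]
    rw [update_sweepStk_rev]
    rfl
  | cons c r ih =>
    rw [List.length_cons, Nat.mul_succ, Nat.add_right_comm]
    refine StepsTo.head (b := sweepCfg M e L (SweepLabel.write c) none (some c) x h r y) ?_
      (StepsTo.head (b := sweepCfg M e L SweepLabel.flush none (some c) x h r (c :: y)) ?_ ?_)
    rotate_left 2
    · simpa using ih none (some c) (c :: y)
    · simp only [sweepCfg, TM2.step, sweepProgram, TM2.stepAux]
      rw [update_sweepStk_rev]
      rfl
    · simp only [sweepCfg, TM2.step, sweepProgram, TM2.stepAux]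
      rw [update_sweepStk_res]
      rfl

/-- Polynomial-time computable functions are closed under finitely many passes of transducers over
the output. -/
theorem computableInPolyTime_sweep [Fintype β] [Fintype γ] {α α' δ αΓ : Type}
    {ea : α → List αΓ} {eb : α' → List β} {ed : δ → List γ} {f : α → α'} {g : α → δ}
    (L : List (Transducer β γ)) (hf : Nonempty (TM2ComputableInPolyTime ea eb f))
    (hg : ∀ a, ed (g a) = Transducer.sweep L (eb (f a))) :
    Nonempty (TM2ComputableInPolyTime ea ed g) := by
  obtain ⟨⟨⟨M, ei, e⟩, t, hM⟩⟩ := hf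
  obtain ⟨B, hB⟩ := exists_pushCount_le M
  obtain ⟨C, hC⟩ := Transducer.exists_length_sweep_le L
  -- `N` bounds the length of the output of `M`. The summands of `T` are the times for running `M`,
  -- for the passes, for clearing the word and for flushing the result.
  let N : Polynomial ℕ := Polynomial.X + Polynomial.C B * t
  let T : Polynomial ℕ := t + Polynomial.C L.length * (4 * N + 3) + (N + 1) +
    (2 * (Polynomial.C C * (N + 1)) + 1)
  refine ⟨⟨⟨sweepMachine M e L, ei, Equiv.refl γ⟩, T, fun a => ?_⟩⟩
  obtain ⟨⟨n, hn⟩, hle⟩ := hM a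
  simp only at hle
  set w := List.map ei.invFun (ea a) with hw
  have hn : StepsTo M.step n (initList M w) (haltList M ((eb (f a)).map e.symm)) := hn
  have hlen : (eb (f a)).length ≤ N.eval (ea a).length := by
    have := hn.length_stk_le hB M.k₁
    rw [haltList_stk_self, List.length_map] at this
    have h0 : ((initList M w).stk M.k₁).length ≤ (ea a).length := by
      -- The output stack of `M` may be its input stack; otherwise it starts empty.
      by_cases hk : M.k₁ = M.k₀
      · have : ∀ k, k = M.k₀ → ((initList M w).stk k).length ≤ (ea a).length := by
          rintro k rfl
          simp [initList, hw]
        exact this _ hk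
      · simp [initList, hk]
    have h1 : B * n ≤ B * t.eval (ea a).length := Nat.mul_le_mul_left _ hle
    simp only [N, Polynomial.eval_add, Polynomial.eval_mul, Polynomial.eval_X, Polynomial.eval_C]
    omega
  set x := eb (f a) with hx
  have h₁ := stepsTo_liftCfg M e L hn
  rw [liftCfg_haltList, liftCfg_initList M e L] at h₁
  have h₂ := steps_sweep_drop M e L x [] [] 0 (Nat.zero_le _)
  rw [List.drop_zero, List.append_nil] at h₂
  have h₃ := steps_clear M e L none none x [] (Transducer.sweep L x).reverse []
  have h₄ := steps_flush M e L none none [] [] (Transducer.sweep L x).reverse []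
  rw [List.append_nil, List.reverse_reverse] at h₄
  have h₅ := ((h₁.trans h₂).trans h₃).trans h₄
  rw [← hg a, haltList_sweepMachine M e L] at h₅
  have hid : ed (g a) = List.map (Equiv.refl γ).invFun (ed (g a)) := (List.map_id _).symm
  refine
    { steps := _
      evals_in_steps := Eq.trans h₅
        (congrArg (fun z => some (haltList (sweepMachine M e L) z)) hid)
      steps_le_m := ?_ }
  · have hs := hC x
    have e1 : L.length * (4 * x.length + 3) ≤ L.length * (4 * N.eval (ea a).length + 3) :=
      Nat.mul_le_mul_left _ (by omega)
    have e2 : C * (x.length + 1) ≤ C * (N.eval (ea a).length + 1) :=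
      Nat.mul_le_mul_left _ (by omega)
    have e4 : (4 : Polynomial ℕ).eval (ea a).length = 4 := Polynomial.eval_ofNat 4 _
    have e3 : (3 : Polynomial ℕ).eval (ea a).length = 3 := Polynomial.eval_ofNat 3 _
    have e2' : (2 : Polynomial ℕ).eval (ea a).length = 2 := Polynomial.eval_ofNat 2 _
    simp only [T, Polynomial.eval_add, Polynomial.eval_mul, Polynomial.eval_C, Polynomial.eval_one,
      e4, e3, e2', List.length_reverse, hg a, ← hx, Nat.sub_zero]
    omega

end Machine

/-! ### Transducers for circuit descriptions -/

noncomputable instance : Fintype Sym := by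
  classical
  exact ⟨{Sym.tick, Sym.sep, Sym.bit false, Sym.bit true, Sym.gate, Sym.out}, fun x => by
    rcases x with _ | _ | _ | _ | _ | _ <;> simp⟩

namespace Transducer

variable {β γ : Type}

/-- The transducer that replaces every letter `a` by the word `h a`. -/
def subst (h : β → List γ) : Transducer β γ where
  Q := Unit
  pre := []
  init := ()
  step _ _ := ()
  out _ a := h a

/-- The transducer that writes `w` and ignores its input. -/
def const (w : List γ) : Transducer β γ where
  Q := Unit
  pre := w
  init := ()
  step _ _ := ()
  out _ _ := []

/-- The transducer that replaces every letter `a` by `h a` up to the first letter satisfying `p`,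
which it replaces by `w`, and then continues with `T`. -/
def upTo (p : β → Bool) (h : β → List γ) (w : List γ) (T : Transducer β γ) : Transducer β γ where
  Q := Option T.Q
  pre := []
  init := none
  step
    | none, a => if p a then some T.init else none
    | some q, a => some (T.step q a)
  out
    | none, a => if p a then w ++ T.pre else h a
    | some q, a => T.out q a

theorem run_subst (h : β → List γ) (l : List β) : (subst h).run l = l.flatMap h := by
  have : ∀ q, (subst h).runFrom q l = l.flatMap h := by
    intro q
    induction l with
    | nil => rfl
    | cons a l ih => exact congrArg (h a ++ ·) ih
  simp [run, this]; rfl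

theorem run_const (w : List γ) (l : List β) : (const w).run l = w := by
  have : ∀ q, (const w : Transducer β γ).runFrom q l = [] := by
    intro q
    induction l with
    | nil => rfl
    | cons a l ih => exact ih
  simp [run, this]; rfl

/-- Nested uses of `upTo` parse a description by its delimiters: the first `sep` ends the leading
numeral, and the only `out` separates the gates from the register. -/
theorem run_upTo (p : β → Bool) (h : β → List γ) (w : List γ) (T : Transducer β γ)
    {l : List β} (hl : ∀ a ∈ l, p a = false) {s : β} (hs : p s = true) (r : List β) :
    (upTo p h w T).run (l ++ s :: r) = l.flatMap h ++ (w ++ T.run r) := by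
  have h₁ : ∀ q, (upTo p h w T).runFrom (some q) r = T.runFrom q r := by
    induction r with
    | nil => intro q; rfl
    | cons a r ih => intro q; simp [runFrom, ← ih]; rfl
  have h₂ : (upTo p h w T).runFrom none (l ++ s :: r) = l.flatMap h ++ (w ++ T.run r) := by
    induction l with
    | nil =>
      have e₁ : (upTo p h w T).step none s = some T.init := by simp [upTo, hs]
      have e₂ : (upTo p h w T).out none s = w ++ T.pre := by simp [upTo, hs]
      simp only [List.nil_append, runFrom, e₁, e₂, h₁, run, List.flatMap_nil, List.append_assoc]
    | cons a l ih =>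
      have ha := hl a (by simp)
      have e₁ : (upTo p h w T).step none a = none := by simp [upTo, ha]
      have e₂ : (upTo p h w T).out none a = h a := by simp [upTo, ha]
      simp only [List.cons_append, runFrom, e₁, e₂, List.flatMap_cons, List.append_assoc]
      rw [ih fun b hb => hl b (by simp [hb])]
  exact h₂

end Transducer

open Transducer

def Sym.isSep : Sym → Bool
  | Sym.sep => true
  | _ => false

def Sym.isOut : Sym → Bool
  | Sym.out => true
  | _ => false

def keep : Sym → List Sym := fun a => [a]

def skip : Sym → List Sym := fun _ => []

theorem flatMap_keep (l : List Sym) : l.flatMap keep = l := List.flatMap_singleton' l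

theorem flatMap_skip (l : List Sym) : l.flatMap skip = [] := by simp [skip]

theorem isSep_replicate_tick (n : ℕ) : ∀ a ∈ List.replicate n Sym.tick, a.isSep = false := by
  intro a ha
  rw [List.eq_of_mem_replicate ha]
  rfl

theorem isOut_encNum (n : ℕ) : ∀ a ∈ encNum n, a.isOut = false := by
  intro a ha
  rw [encNum, List.mem_append, List.mem_singleton] at ha
  rcases ha with ha | rfl
  · rw [List.eq_of_mem_replicate ha]; rfl
  · rfl

theorem encNum_append (n : ℕ) (l : List Sym) :
    encNum n ++ l = List.replicate n Sym.tick ++ Sym.sep :: l := by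
  simp [encNum]

theorem run_upTo_isSep_encNum (h : Sym → List Sym) (w : List Sym) (T : Transducer Sym Sym)
    (n : ℕ) (l : List Sym) :
    (upTo Sym.isSep h w T).run (encNum n ++ l) =
      (List.replicate n Sym.tick).flatMap h ++ (w ++ T.run l) := by
  rw [encNum_append, run_upTo _ _ _ _ (isSep_replicate_tick n) rfl]

/-! ### Parallel copies of an IQP circuit -/

variable {G : GateSet}

/-- The line of the copy number `j` that corresponds to the line `i`. -/
def copyLine {N K : ℕ} (j : Fin K) (i : Fin N) : Fin (N * K) := finProdFinEquiv (i, j)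

/-- Interleaving the copies makes the renaming a letter substitution on unary numerals: every tick
becomes `K` ticks and the separator gains `j` ticks. Placing the copies side by side would require
the unbounded offset `j * N`. -/
theorem copyLine_val {N K : ℕ} (j : Fin K) (i : Fin N) :
    (copyLine j i : ℕ) = j + K * i := rfl

theorem copyLine_inj {N K : ℕ} {j j' : Fin K} {i i' : Fin N} :
    copyLine j i = copyLine j' i' ↔ i = i' ∧ j = j' := by
  simp [copyLine]

theorem nodup_flatMap_copyLine {N : ℕ} (K : ℕ) {r : List (Fin N)} (hr : r.Nodup) :
    ((List.finRange K).flatMap fun j => r.map (copyLine j)).Nodup := by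
  rw [List.nodup_flatMap]
  refine ⟨fun j _ => hr.map fun i i' h => (copyLine_inj.1 h).1, ?_⟩
  refine (List.nodup_finRange K).imp fun {j j'} hj => ?_
  intro l hl hl'
  obtain ⟨i, _, rfl⟩ := List.mem_map.1 hl
  obtain ⟨i', _, h⟩ := List.mem_map.1 hl'
  exact hj (copyLine_inj.1 h).2.symm

/-- A gate, placed on the lines of the copy number `j`. -/
def PlacedGate.copy {N K : ℕ} (j : Fin K) (g : PlacedGate G N) : PlacedGate G (N * K) where
  name := g.name
  on := g.on.trans ⟨copyLine j, fun _ _ h => (copyLine_inj.1 h).1⟩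

/-- `K` copies of a circuit, run in parallel. The register consists of the first lines of the
registers of all copies, followed by all other lines of these registers. -/
def IQPCircuit.copies (K : ℕ) (C : IQPCircuit G) : IQPCircuit G where
  lines := C.lines * K
  gates := (List.finRange K).flatMap fun j => C.gates.map (PlacedGate.copy j)
  -- With the output lines in front, their positions do not depend on the size of the post-selection
  -- register, so finite memory can locate them later.
  reg := ((List.finRange K).flatMap fun j => (C.reg.take 1).map (copyLine j)) ++
    (List.finRange K).flatMap fun j => (C.reg.drop 1).map (copyLine j)
  reg_nodup := by
    refine List.Nodup.append (nodup_flatMap_copyLine K (C.reg_nodup.sublist (List.take_sublist _ _)))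
      (nodup_flatMap_copyLine K (C.reg_nodup.sublist (List.drop_sublist _ _))) ?_
    intro l hl hl'
    simp only [List.mem_flatMap, List.mem_map] at hl hl'
    obtain ⟨j, _, i, hi, rfl⟩ := hl
    obtain ⟨j', _, i', hi', h⟩ := hl'
    obtain rfl := (copyLine_inj.1 h).1
    exact List.disjoint_take_drop C.reg_nodup le_rfl hi hi'

/-- The renaming of lines for the copy number `j` of `K`, on descriptions. -/
def copySubst (K j : ℕ) : Sym → List Sym
  | Sym.tick => List.replicate K Sym.tick
  | Sym.sep => List.replicate j Sym.tick ++ [Sym.sep]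
  | a => [a]

theorem flatMap_copySubst_replicate (K j n : ℕ) :
    (List.replicate n Sym.tick).flatMap (copySubst K j) = List.replicate (K * n) Sym.tick := by
  induction n with
  | zero => rfl
  | succ n ih =>
    rw [List.replicate_succ, List.flatMap_cons, ih, Nat.mul_succ, Nat.add_comm,
      List.replicate_add]
    rfl

theorem flatMap_copySubst_encNum (K j n : ℕ) :
    (encNum n).flatMap (copySubst K j) = encNum (j + K * n) := by
  rw [encNum, List.flatMap_append, flatMap_copySubst_replicate, encNum, Nat.add_comm,
    List.replicate_add, List.append_assoc]
  simp [copySubst]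

def encLines {N : ℕ} (r : List (Fin N)) : List Sym := r.flatMap fun i : Fin N => encNum i

def encGate {N : ℕ} (g : PlacedGate G N) : List Sym :=
  Sym.gate :: g.name.map Sym.bit ++ (List.ofFn fun j => (g.on j : ℕ)).flatMap encNum

theorem isOut_encGate {N : ℕ} (g : PlacedGate G N) : ∀ a ∈ encGate g, a.isOut = false := by
  intro a ha
  simp only [encGate, List.cons_append, List.mem_cons, List.mem_append, List.mem_map,
    List.mem_flatMap] at ha
  rcases ha with rfl | ⟨b, _, rfl⟩ | ⟨i, _, hi⟩
  · rfl
  · rfl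
  · exact isOut_encNum _ a hi

theorem encGate_copy {N K : ℕ} (j : Fin K) (g : PlacedGate G N) :
    encGate (g.copy j) = (encGate g).flatMap (copySubst K j) := by
  have h₁ : (g.name.map Sym.bit).flatMap (copySubst K j) = g.name.map Sym.bit := by
    rw [List.flatMap_map]
    exact (List.map_eq_flatMap).symm
  simp only [encGate, List.cons_append, List.flatMap_cons, List.flatMap_append, h₁]
  simp only [List.flatMap_assoc, flatMap_copySubst_encNum]
  have h₂ : (List.ofFn fun i => ((g.copy j).on i : ℕ)) =
      (List.ofFn fun i => (g.on i : ℕ)).map (fun i => j + K * i) := by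
    rw [List.map_ofFn]; rfl
  rw [h₂, List.flatMap_map]
  rfl

theorem flatMap_encNum_copyLine {N K : ℕ} (j : Fin K) (r : List (Fin N)) :
    encLines (r.map (copyLine j)) = (encLines r).flatMap (copySubst K j) := by
  simp only [encLines, List.flatMap_map, List.flatMap_assoc, flatMap_copySubst_encNum, copyLine_val]

theorem IQPCircuit.encode_eq (C : IQPCircuit G) :
    C.encode = encNum C.lines ++
      (C.gates.flatMap encGate ++ Sym.out :: encLines C.reg) := by
  simp only [IQPCircuit.encode, List.append_assoc, encLines, List.bind_eq_flatMap, List.pure_def,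
    List.flatMap_assoc, List.flatMap_singleton]
  rfl

/-- The passes that turn the description of a circuit into that of `K` copies. -/
def copyPasses (K : ℕ) : List (Transducer Sym Sym) :=
  -- The index `0` is immaterial: the substitution only meets ticks here, as the separator is
  -- written explicitly.
  upTo Sym.isSep (copySubst K 0) [Sym.sep] (const []) ::
    ((List.finRange K).map fun j : Fin K =>
      upTo Sym.isSep skip [] (upTo Sym.isOut (copySubst K j) [] (const []))) ++
    const [Sym.out] ::
    ((List.finRange K).map fun j : Fin K =>
      upTo Sym.isOut skip [] (upTo Sym.isSep (copySubst K j)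
        (List.replicate j Sym.tick ++ [Sym.sep]) (const []))) ++
    ((List.finRange K).map fun j : Fin K =>
      upTo Sym.isOut skip [] (upTo Sym.isSep skip [] (subst (copySubst K j))))

theorem IQPCircuit.encode_copies (K : ℕ) (C : IQPCircuit G) :
    (C.copies K).encode = sweep (copyPasses K) C.encode := by
  have hg : ∀ a ∈ C.gates.flatMap encGate, a.isOut = false := by
    intro a ha
    obtain ⟨g, _, hg⟩ := List.mem_flatMap.1 ha
    exact isOut_encGate g a hg
  have hhdr : ∀ a ∈ encNum C.lines ++ C.gates.flatMap encGate, a.isOut = false := by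
    intro a ha
    rcases List.mem_append.1 ha with ha | ha
    · exact isOut_encNum _ a ha
    · exact hg a ha
  have hreg : ∀ T : Transducer Sym Sym, (upTo Sym.isOut skip [] T).run C.encode =
      T.run (encLines C.reg) := by
    intro T
    rw [C.encode_eq, ← List.append_assoc, run_upTo _ _ _ _ hhdr rfl, flatMap_skip]
    rfl
  have e₁ : (upTo Sym.isSep (copySubst K 0) [Sym.sep] (const [])).run C.encode =
      encNum (C.lines * K) := by
    rw [C.encode_eq, run_upTo_isSep_encNum, flatMap_copySubst_replicate, run_const, encNum,
      Nat.mul_comm]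
    rfl
  have e₂ : ∀ j : Fin K, (upTo Sym.isSep skip []
      (upTo Sym.isOut (copySubst K j) [] (const []))).run C.encode =
      (C.gates.map (PlacedGate.copy j)).flatMap encGate := by
    intro j
    rw [C.encode_eq, run_upTo_isSep_encNum, flatMap_skip, run_upTo _ _ _ _ hg rfl, run_const]
    simp only [List.nil_append, List.append_nil, List.flatMap_map, List.flatMap_assoc,
      encGate_copy]
  have e₃ : ∀ j : Fin K, (upTo Sym.isOut skip [] (upTo Sym.isSep (copySubst K j)
        (List.replicate j Sym.tick ++ [Sym.sep]) (const []))).run C.encode =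
      encLines ((C.reg.take 1).map (copyLine j)) := by
    intro j
    rw [hreg, flatMap_encNum_copyLine]
    rcases C.reg with _ | ⟨o, P⟩
    · rfl
    · rw [encLines, List.flatMap_cons, run_upTo_isSep_encNum, run_const, flatMap_copySubst_replicate]
      have h : encLines (List.take 1 (o :: P)) = encNum o := by simp [encLines]
      rw [h, flatMap_copySubst_encNum, encNum, Nat.add_comm (j : ℕ), List.replicate_add]
      simp only [List.append_assoc, List.append_nil]
  have e₄ : ∀ j : Fin K, (upTo Sym.isOut skip [] (upTo Sym.isSep skip []
      (subst (copySubst K j)))).run C.encode =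
      encLines ((C.reg.drop 1).map (copyLine j)) := by
    intro j
    rw [hreg, flatMap_encNum_copyLine]
    rcases C.reg with _ | ⟨o, P⟩
    · rfl
    · rw [encLines, List.flatMap_cons, run_upTo_isSep_encNum, run_subst, flatMap_skip]
      rfl
  rw [IQPCircuit.encode_eq]
  simp only [sweep, copyPasses, List.flatMap_cons, List.flatMap_append, List.flatMap_map,
    e₁, e₂, e₃, e₄, run_const, copies, List.flatMap_assoc, List.append_assoc, List.cons_append,
    List.nil_append]
  simp only [encLines, List.flatMap_append, List.flatMap_assoc]

/-- The number `K` is the same for all `w`, so one fixed list of passes serves the whole family. -/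
theorem uniform_copies (K : ℕ) {C : List Bool → IQPCircuit G}
    (hC : Uniform IQPCircuit.encode C) :
    Uniform IQPCircuit.encode fun w => (C w).copies K :=
  computableInPolyTime_sweep (copyPasses K) hC fun w => (C w).encode_copies K

/-! ### Post-selecting a classical circuit on unanimity -/

section Lines

variable {a r m : ℕ}

/-- A line of a circuit, as a line of the circuit with `m` more auxiliary lines. -/
def oldLine (m : ℕ) : CLine a r → CLine (a + m) r := Sum.map (Fin.castAdd m) id

/-- An additional auxiliary line. -/
def newLine (t : Fin m) : CLine (a + m) r := Sum.inl (Fin.natAdd a t)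

theorem oldLine_inj {l l' : CLine a r} : oldLine m l = oldLine m l' ↔ l = l' :=
  (Sum.map_injective.2 ⟨Fin.castAdd_injective a m, Function.injective_id⟩).eq_iff

theorem newLine_inj {t t' : Fin m} : (newLine t : CLine (a + m) r) = newLine t' ↔ t = t' := by
  simp [newLine]

theorem oldLine_ne_newLine (l : CLine a r) (t : Fin m) : oldLine m l ≠ newLine t := by
  rcases l with i | i
  · intro h
    have h := congrArg Fin.val (Sum.inl.inj h)
    have := i.isLt
    simp at h
    omega
  · simp [oldLine, newLine]

def NandGate.lift (m : ℕ) (g : NandGate a r) : NandGate (a + m) r :=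
  ⟨oldLine m g.in₁, oldLine m g.in₂, oldLine m g.tgt⟩

theorem foldl_lift_oldLine (L : List (NandGate a r)) (s : CLine (a + m) r → Bool) (l : CLine a r) :
    (L.map (NandGate.lift m)).foldl NandGate.apply s (oldLine m l) =
      L.foldl NandGate.apply (fun l => s (oldLine m l)) l := by
  induction L generalizing s with
  | nil => rfl
  | cons g L ih =>
    rw [List.map_cons, List.foldl_cons, ih, List.foldl_cons]
    refine congrFun (congrArg (fun s => L.foldl NandGate.apply s) (funext fun l => ?_)) l
    simp only [NandGate.apply, NandGate.lift, Function.update_apply, oldLine_inj]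

/-- The work line number `t` of the block number `j`. -/
def workLine {K : ℕ} (j : Fin K) (t : Fin 4) : CLine (a + K * 4) r :=
  newLine (finProdFinEquiv (j, t))

theorem workLine_inj {K : ℕ} {j j' : Fin K} {t t' : Fin 4} :
    (workLine j t : CLine (a + K * 4) r) = workLine j' t' ↔ j = j' ∧ t = t' := by
  simp [workLine, newLine_inj]

theorem oldLine_ne_workLine {K : ℕ} (l : CLine a r) (j : Fin K) (t : Fin 4) :
    oldLine (K * 4) l ≠ workLine j t :=
  oldLine_ne_newLine l _

/-- Gates that write the exclusive or of two lines on the last work line of the block `j`. -/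
def xorGates {K : ℕ} (x y : CLine a r) (j : Fin K) : List (NandGate (a + K * 4) r) :=
  [⟨oldLine _ x, oldLine _ y, workLine j 0⟩, ⟨oldLine _ x, workLine j 0, workLine j 1⟩,
    ⟨oldLine _ y, workLine j 0, workLine j 2⟩, ⟨workLine j 1, workLine j 2, workLine j 3⟩]

variable {K : ℕ} (x : CLine a r) (y : Fin K → CLine a r)

theorem foldl_xorGates_oldLine (z : CLine a r) (j : Fin K) (s : CLine (a + K * 4) r → Bool)
    (l : CLine a r) :
    (xorGates x z j).foldl NandGate.apply s (oldLine _ l) = s (oldLine _ l) := by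
  simp [xorGates, NandGate.apply, Function.update_apply, oldLine_ne_workLine]

theorem foldl_xorGates_of_ne (z : CLine a r) {i j : Fin K} (h : i ≠ j)
    (s : CLine (a + K * 4) r → Bool) (t : Fin 4) :
    (xorGates x z j).foldl NandGate.apply s (workLine i t) = s (workLine i t) := by
  simp [xorGates, NandGate.apply, Function.update_apply, workLine_inj, h]

/-- This is the standard four-gate exclusive or: with `u = NAND(x, z)` it equals `NAND(NAND(x, u),
NAND(z, u))`. -/
theorem foldl_xorGates_self (z : CLine a r) (j : Fin K) (s : CLine (a + K * 4) r → Bool) :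
    (xorGates x z j).foldl NandGate.apply s (workLine j 3) =
      xor (s (oldLine _ x)) (s (oldLine _ z)) := by
  simp only [xorGates, NandGate.apply, Function.update_apply, oldLine_ne_workLine, workLine_inj,
    List.foldl_cons, List.foldl_nil]
  simp only [if_true, if_false, true_and, show ¬ ((1 : Fin 4) = 0) by decide,
    show ¬ ((1 : Fin 4) = 2) by decide, show ¬ ((0 : Fin 4) = 1) by decide]
  cases s (oldLine _ x) <;> cases s (oldLine _ z) <;> rfl

theorem foldl_flatMap_xorGates_oldLine (J : List (Fin K)) (s : CLine (a + K * 4) r → Bool)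
    (l : CLine a r) :
    (J.flatMap fun j => xorGates x (y j) j).foldl NandGate.apply s (oldLine _ l) =
      s (oldLine _ l) := by
  induction J generalizing s with
  | nil => rfl
  | cons j J ih =>
    rw [List.flatMap_cons, List.foldl_append, ih, foldl_xorGates_oldLine]

theorem foldl_flatMap_xorGates_of_notMem {J : List (Fin K)} {i : Fin K} (hi : i ∉ J)
    (s : CLine (a + K * 4) r → Bool) (t : Fin 4) :
    (J.flatMap fun j => xorGates x (y j) j).foldl NandGate.apply s (workLine i t) =
      s (workLine i t) := by
  induction J generalizing s with
  | nil => rfl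
  | cons j J ih =>
    rw [List.mem_cons, not_or] at hi
    rw [List.flatMap_cons, List.foldl_append, ih hi.2, foldl_xorGates_of_ne x _ hi.1]

theorem foldl_flatMap_xorGates_of_mem {J : List (Fin K)} {i : Fin K} (hi : i ∈ J)
    (s : CLine (a + K * 4) r → Bool) :
    (J.flatMap fun j => xorGates x (y j) j).foldl NandGate.apply s (workLine i 3) =
      xor (s (oldLine _ x)) (s (oldLine _ (y i))) := by
  induction J generalizing s with
  | nil => simp at hi
  | cons j J ih =>
    rw [List.flatMap_cons, List.foldl_append]
    by_cases h : i ∈ J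
    · rw [ih h, foldl_xorGates_oldLine, foldl_xorGates_oldLine]
    · obtain rfl : i = j := (List.mem_cons.1 hi).resolve_right h
      rw [foldl_flatMap_xorGates_of_notMem x y h, foldl_xorGates_self]

end Lines

namespace RandCircuit

variable (R : RandCircuit) {K : ℕ} (hK : 0 < K) (hR : K ≤ R.reg.length)

/-- The line number `j` of the register. -/
def regLine (j : Fin K) : CLine R.aux R.rand := R.reg[j]

/-- The circuit that compares the first `K` lines of the register of `R` with its first line. The
new register consists of this line, the results of the comparisons, and the other lines of the
register of `R`. -/
def unanimous : RandCircuit where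
  aux := R.aux + K * 4
  rand := R.rand
  gates := R.gates.map (NandGate.lift (K * 4)) ++
    (List.finRange K).flatMap fun j =>
      xorGates (R.regLine hR ⟨0, hK⟩) (R.regLine hR j) j
  -- The comparison number `0` is of the first line with itself and always reads `0`; keeping it
  -- avoids an index shift.
  reg := oldLine _ (R.regLine hR ⟨0, hK⟩) ::
    ((List.finRange K).map (fun j => workLine j 3) ++ (R.reg.drop K).map (oldLine _))
  reg_nodup := by
    have h₁ : ((List.finRange K).map fun j =>
        (workLine j 3 : CLine (R.aux + K * 4) R.rand)).Nodup :=
      (List.nodup_finRange K).map fun i j h => (workLine_inj.1 h).1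
    have h₂ : ((R.reg.drop K).map (oldLine (K * 4))).Nodup :=
      (R.reg_nodup.sublist (List.drop_sublist _ _)).map fun l l' h => oldLine_inj.1 h
    refine List.nodup_cons.2 ⟨?_, h₁.append h₂ ?_⟩
    · rw [List.mem_append, not_or]
      refine ⟨fun h => ?_, fun h => ?_⟩
      · obtain ⟨j, _, h⟩ := List.mem_map.1 h
        exact oldLine_ne_workLine _ _ _ h.symm
      · obtain ⟨l, hl, h⟩ := List.mem_map.1 h
        rw [oldLine_inj.1 h] at hl
        -- A repetition of the first register line beyond position `K` would contradict
        -- `R.reg_nodup`, because `0 < K`.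
        obtain ⟨i, hi, h⟩ := List.mem_iff_getElem.1 hl
        rw [List.getElem_drop] at h
        have := (R.reg_nodup.getElem_inj_iff).1 h
        simp at this
        omega
    · intro l hl hl'
      obtain ⟨j, _, rfl⟩ := List.mem_map.1 hl
      obtain ⟨l, _, h⟩ := List.mem_map.1 hl'
      exact oldLine_ne_workLine _ _ _ h

theorem length_reg_unanimous :
    (R.unanimous hK hR).reg.length = K + (R.reg.length - K) + 1 := by
  have h : (oldLine (K * 4) (R.regLine hR ⟨0, hK⟩) :: ((List.finRange K).map
      (fun j => (workLine j 3 : CLine (R.aux + K * 4) R.rand)) ++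
      (R.reg.drop K).map (oldLine (K * 4)))).length = K + (R.reg.length - K) + 1 := by
    simp only [List.length_cons, List.length_append, List.length_map, List.length_finRange,
      List.length_drop]
  exact h

theorem eval_unanimous_oldLine (ρ : Fin R.rand → Bool) (l : CLine R.aux R.rand) :
    (R.unanimous hK hR).eval ρ (oldLine _ l) = R.eval ρ l := by
  simp only [eval, unanimous, List.foldl_append]
  rw [foldl_flatMap_xorGates_oldLine, foldl_lift_oldLine]
  refine congrFun (congrArg (fun s => R.gates.foldl NandGate.apply s) (funext fun l => ?_)) l
  rcases l with i | i <;> rfl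

theorem eval_unanimous_workLine (ρ : Fin R.rand → Bool) (j : Fin K) :
    (R.unanimous hK hR).eval ρ (workLine j 3) =
      xor (R.eval ρ (R.regLine hR ⟨0, hK⟩)) (R.eval ρ (R.regLine hR j)) := by
  rw [← R.eval_unanimous_oldLine hK hR, ← R.eval_unanimous_oldLine hK hR]
  simp only [eval, unanimous, List.foldl_append]
  rw [foldl_flatMap_xorGates_of_mem _ _ (List.mem_finRange j),
    foldl_flatMap_xorGates_oldLine, foldl_flatMap_xorGates_oldLine]

/-- The random bits determine all final values, so a register event is a set of seeds. A circuit and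
its unanimity version share their seeds and can be compared one seed at a time. -/
theorem regProb_law (r : List (CLine R.aux R.rand)) (y : List Bool) :
    regProb R.law r y =
      ((Finset.univ.filter fun ρ => r.map (R.eval ρ) = y).card : ℝ) / 2 ^ R.rand := by
  have h : ∀ x, (if r.map x = y then R.law x else 0) =
      (∑ ρ, if R.eval ρ = x then (if r.map x = y then (1 : ℝ) else 0) else 0) / 2 ^ R.rand := by
    intro x
    split_ifs <;> simp [law]
  simp only [regProb, h]
  rw [← Finset.sum_div, Finset.sum_comm]
  simp

theorem reg_eq_append :
    R.reg = (List.finRange K).map (R.regLine hR) ++ R.reg.drop K := by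
  conv_lhs => rw [← List.take_append_drop K R.reg]
  congr 1
  refine List.ext_getElem (by simpa using hR) fun i _ _ => ?_
  simp [regLine]

theorem append_eq_append_iff {α : Type} {s s' t t' : List α} (h : s.length = s'.length) :
    s ++ t = s' ++ t' ↔ s = s' ∧ t = t' :=
  ⟨fun e => List.append_inj e h, fun ⟨e, e'⟩ => by rw [e, e']⟩

/-- If the first line shows `b`, vanishing comparisons mean that all `K` lines show `b`.
Post-selection thus keeps exactly the two unanimous outcomes, and the first line tells them apart.
-/
theorem map_eval_unanimous_iff (ρ : Fin R.rand → Bool) (b : Bool) :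
    (R.unanimous hK hR).reg.map ((R.unanimous hK hR).eval ρ) =
        b :: List.replicate (K + (R.reg.length - K)) false ↔
      R.reg.map (R.eval ρ) =
        List.replicate K b ++ List.replicate (R.reg.length - K) false := by
  have h₁ : (R.unanimous hK hR).reg.map ((R.unanimous hK hR).eval ρ) =
      R.eval ρ (R.regLine hR ⟨0, hK⟩) ::
        ((List.finRange K).map (fun j =>
          xor (R.eval ρ (R.regLine hR ⟨0, hK⟩)) (R.eval ρ (R.regLine hR j))) ++
        (R.reg.drop K).map (R.eval ρ)) := by
    suffices key : ∀ f : CLine (R.aux + K * 4) R.rand → Bool,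
        (∀ l, f (oldLine _ l) = R.eval ρ l) →
        (∀ j, f (workLine j 3) =
          xor (R.eval ρ (R.regLine hR ⟨0, hK⟩)) (R.eval ρ (R.regLine hR j))) →
        (oldLine _ (R.regLine hR ⟨0, hK⟩) :: ((List.finRange K).map (fun j => workLine j 3) ++
          (R.reg.drop K).map (oldLine _))).map f = _ from
      key _ (R.eval_unanimous_oldLine hK hR ρ) (R.eval_unanimous_workLine hK hR ρ)
    intro f hold hwork
    rw [List.map_cons, List.map_append, List.map_map, List.map_map]
    exact congr_arg₂ List.cons (hold _) (congr_arg₂ (· ++ ·)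
      (List.map_congr_left fun j _ => hwork j) (List.map_congr_left fun l _ => hold l))
  have h₂ : R.reg.map (R.eval ρ) =
      (List.finRange K).map (fun j => R.eval ρ (R.regLine hR j)) ++
        (R.reg.drop K).map (R.eval ρ) := by
    conv_lhs => rw [R.reg_eq_append hR, List.map_append, List.map_map]
    rfl
  rw [h₁, h₂, List.cons.injEq, List.replicate_add,
    append_eq_append_iff (by simp), append_eq_append_iff (by simp), ← and_assoc]
  refine and_congr_left fun _ => ?_
  simp only [List.eq_replicate_iff, List.length_map, List.length_finRange, List.mem_map,
    List.mem_finRange, true_and, forall_exists_index, forall_apply_eq_imp_iff]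
  constructor
  · rintro ⟨h, h'⟩ j
    have := h' j
    rw [h] at this
    revert this
    cases b <;> cases R.eval ρ (R.regLine hR j) <;> simp
  · intro h
    exact ⟨h _, fun j => by rw [h, h]; simp⟩

theorem regProb_unanimous (b : Bool) :
    regProb (R.unanimous hK hR).law (R.unanimous hK hR).reg
        (b :: List.replicate (K + (R.reg.length - K)) false) =
      R.outProb (List.replicate K b ++ List.replicate (R.reg.length - K) false) := by
  rw [outProb, regProb_law, regProb_law]
  exact congrArg (fun n : ℕ => (n : ℝ) / 2 ^ R.rand) (congrArg Finset.card
    (Finset.filter_congr fun ρ _ => R.map_eval_unanimous_iff hK hR ρ b))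

/-! ### The description of the new circuit -/

end RandCircuit

def encCLines {a r : ℕ} (L : List (CLine a r)) : List Sym := L.flatMap encLine

def encNand {a r : ℕ} (g : NandGate a r) : List Sym :=
  Sym.gate :: encLine g.in₁ ++ encLine g.in₂ ++ encLine g.tgt

/-- New auxiliary lines are numbered after the old ones, and random lines are numbered separately,
so the old gates can be copied verbatim. -/
theorem encLine_oldLine {a r : ℕ} (m : ℕ) (l : CLine a r) : encLine (oldLine m l) = encLine l := by
  rcases l with i | i <;> rfl

theorem encNand_lift {a r : ℕ} (m : ℕ) (g : NandGate a r) : encNand (g.lift m) = encNand g := by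
  simp [encNand, NandGate.lift, encLine_oldLine]

theorem exists_encLine {a r : ℕ} (l : CLine a r) :
    ∃ w, encLine l = w ++ [Sym.sep] ∧ ∀ c ∈ w, c.isSep = false := by
  have h : ∀ (b : Bool) (n : ℕ), ∀ c ∈ Sym.bit b :: List.replicate n Sym.tick, c.isSep = false := by
    intro b n c hc
    rcases List.mem_cons.1 hc with rfl | hc
    · rfl
    · exact isSep_replicate_tick n c hc
  rcases l with i | i
  · exact ⟨_, rfl, h false i⟩
  · exact ⟨_, rfl, h true i⟩

theorem isOut_encLine {a r : ℕ} (l : CLine a r) : ∀ c ∈ encLine l, c.isOut = false := by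
  intro c hc
  rcases l with i | i
  all_goals
    rcases List.mem_cons.1 hc with rfl | hc
    · rfl
    · exact isOut_encNum _ c hc

theorem isOut_encNand {a r : ℕ} (g : NandGate a r) : ∀ c ∈ encNand g, c.isOut = false := by
  intro c hc
  simp only [encNand, List.cons_append, List.mem_cons, List.mem_append] at hc
  rcases hc with rfl | (hc | hc) | hc
  · rfl
  all_goals exact isOut_encLine _ c hc

/-- The transducer that writes the description of the additional auxiliary line number `t`. -/
def newLinePass (t : ℕ) : List (Transducer Sym Sym) :=
  [const [Sym.bit false],
    -- The leading ticks of the description count the old auxiliary lines, which is the offset of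
    -- the new ones.
    upTo Sym.isSep keep (List.replicate t Sym.tick ++ [Sym.sep]) (const [])]

/-- The transducer that skips `t` words ending with `sep` and then continues with `T`. -/
def skipWords (t : ℕ) (T : Transducer Sym Sym) : Transducer Sym Sym :=
  (upTo Sym.isSep skip [])^[t] T

theorem run_skipWords {a r : ℕ} (T : Transducer Sym Sym) (t : ℕ) (L : List (CLine a r))
    (ht : t ≤ L.length) : (skipWords t T).run (encCLines L) = T.run (encCLines (L.drop t)) := by
  induction t generalizing L with
  | zero => rfl
  | succ t ih =>
    rcases L with _ | ⟨l, L⟩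
    · simp at ht
    · obtain ⟨w, hw, hs⟩ := exists_encLine l
      rw [skipWords, Function.iterate_succ_apply', encCLines, List.flatMap_cons, hw,
        List.append_assoc, List.singleton_append, run_upTo _ _ _ _ hs rfl, flatMap_skip]
      exact ih L (by simpa using ht)

/-- The transducer that writes the description of the line number `t` of the register. -/
def regLinePass (t : ℕ) : List (Transducer Sym Sym) :=
  [upTo Sym.isOut skip [] (skipWords t (upTo Sym.isSep keep [Sym.sep] (const [])))]

def workLinePass (j t : ℕ) : List (Transducer Sym Sym) := newLinePass (t + 4 * j)

def xorPasses (j : ℕ) : List (Transducer Sym Sym) :=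
  const [Sym.gate] :: (regLinePass 0 ++ regLinePass j ++ workLinePass j 0) ++
  const [Sym.gate] :: (regLinePass 0 ++ workLinePass j 0 ++ workLinePass j 1) ++
  const [Sym.gate] :: (regLinePass j ++ workLinePass j 0 ++ workLinePass j 2) ++
  const [Sym.gate] :: (workLinePass j 1 ++ workLinePass j 2 ++ workLinePass j 3)

/-- The passes that turn the description of a circuit `R` into that of `R.unanimous`. -/
def unanimousPasses (K : ℕ) : List (Transducer Sym Sym) :=
  -- Replacing the first separator by a whole numeral adds `K * 4` to the number of auxiliary lines.
  upTo Sym.isSep keep (encNum (K * 4)) (upTo Sym.isOut keep [] (const [])) ::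
  ((List.finRange K).flatMap fun j : Fin K => xorPasses j) ++
  const [Sym.out] :: regLinePass 0 ++
  ((List.finRange K).flatMap fun j : Fin K => workLinePass j 3) ++
  [upTo Sym.isOut skip [] (skipWords K (subst keep))]

namespace RandCircuit

theorem encode_eq (R : RandCircuit) :
    R.encode = encNum R.aux ++
      ((encNum R.rand ++ R.gates.flatMap encNand) ++ Sym.out :: encCLines R.reg) := by
  have h : (encNand : NandGate R.aux R.rand → List Sym) =
    fun g => Sym.gate :: encLine g.in₁ ++ encLine g.in₂ ++ encLine g.tgt := rfl
  simp only [encode, h, encCLines, List.append_assoc]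

variable (R : RandCircuit) {K : ℕ} (hK : 0 < K) (hR : K ≤ R.reg.length)

theorem isOut_encNum_append_encNand (R : RandCircuit) :
    ∀ c ∈ encNum R.rand ++ R.gates.flatMap encNand, c.isOut = false := by
  intro c hc
  rcases List.mem_append.1 hc with hc | hc
  · exact isOut_encNum _ c hc
  · obtain ⟨g, _, hg⟩ := List.mem_flatMap.1 hc
    exact isOut_encNand g c hg

theorem run_upTo_isOut (T : Transducer Sym Sym) :
    (upTo Sym.isOut skip [] T).run R.encode = T.run (encCLines R.reg) := by
  have h : ∀ c ∈ encNum R.aux ++ (encNum R.rand ++ R.gates.flatMap encNand), c.isOut = false := by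
    intro c hc
    rcases List.mem_append.1 hc with hc | hc
    · exact isOut_encNum _ c hc
    · exact R.isOut_encNum_append_encNand c hc
  rw [encode_eq, ← List.append_assoc, run_upTo _ _ _ _ h rfl, flatMap_skip]
  rfl

theorem sweep_workLinePass (j : Fin K) (t : Fin 4) :
    sweep (workLinePass j t) R.encode =
      encLine (workLine j t : CLine (R.aux + K * 4) R.rand) := by
  simp only [sweep, workLinePass, newLinePass, List.flatMap_cons, List.flatMap_nil, run_const,
    R.encode_eq, run_upTo_isSep_encNum, flatMap_keep]
  have : ((Fin.natAdd R.aux (finProdFinEquiv (j, t)) : Fin (R.aux + K * 4)) : ℕ) =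
    R.aux + (t + 4 * j) := rfl
  rw [workLine, newLine, encLine, this, encNum, List.replicate_add R.aux]
  simp only [List.append_assoc, List.append_nil, List.cons_append, List.nil_append]

theorem sweep_regLinePass (j : Fin K) :
    sweep (regLinePass j) R.encode = encLine (R.regLine hR j) := by
  have hj : (j : ℕ) < R.reg.length := j.isLt.trans_le hR
  simp only [sweep, regLinePass, List.flatMap_cons, List.flatMap_nil, run_upTo_isOut,
    List.append_nil]
  rw [run_skipWords _ _ _ hj.le, List.drop_eq_getElem_cons hj, encCLines, List.flatMap_cons]
  obtain ⟨w, hw, hs⟩ := exists_encLine R.reg[(j : ℕ)]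
  rw [hw, List.append_assoc, List.singleton_append, run_upTo _ _ _ _ hs rfl, flatMap_keep,
    run_const, List.append_nil, ← hw]
  rfl

theorem encode_unanimous :
    (R.unanimous hK hR).encode = sweep (unanimousPasses K) R.encode := by
  have e₁ : (upTo Sym.isSep keep (encNum (K * 4)) (upTo Sym.isOut keep [] (const []))).run
      R.encode = encNum (R.aux + K * 4) ++ (encNum R.rand ++ R.gates.flatMap encNand) := by
    rw [R.encode_eq, run_upTo_isSep_encNum, run_upTo _ _ _ _ R.isOut_encNum_append_encNand rfl,
      flatMap_keep, flatMap_keep, run_const]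
    simp only [encNum, List.replicate_add R.aux, List.append_assoc, List.append_nil]
  have e₂ : ∀ j : Fin K, sweep (xorPasses j) R.encode =
      (xorGates (R.regLine hR ⟨0, hK⟩) (R.regLine hR j) j).flatMap encNand := by
    intro j
    have h₀ := R.sweep_regLinePass hR ⟨0, hK⟩
    have hj := R.sweep_regLinePass hR j
    have w₀ := R.sweep_workLinePass j 0
    have w₁ := R.sweep_workLinePass j 1
    have w₂ := R.sweep_workLinePass j 2
    have w₃ := R.sweep_workLinePass j 3
    simp only [sweep, Fin.val_zero, Fin.val_one, Fin.val_two] at h₀ hj w₀ w₁ w₂ w₃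
    have w₃' : (workLinePass j 3).flatMap (fun T => T.run R.encode) =
      encLine (workLine j 3 : CLine (R.aux + K * 4) R.rand) := w₃
    simp only [sweep, xorPasses, List.flatMap_cons, List.flatMap_append, run_const, h₀, hj, w₀, w₁,
      w₂, w₃', xorGates, encNand, encLine_oldLine, List.flatMap_nil, List.append_assoc,
      List.cons_append, List.nil_append, List.append_nil]
  have e₃ : (upTo Sym.isOut skip [] (skipWords K (subst keep))).run R.encode =
      encCLines (R.reg.drop K) := by
    rw [run_upTo_isOut, run_skipWords _ _ _ hR, run_subst, flatMap_keep]
  have e₄ := R.sweep_regLinePass hR ⟨0, hK⟩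
  have e₅ : ∀ j : Fin K, (workLinePass j 3).flatMap (fun T => T.run R.encode) =
      encLine (workLine j 3 : CLine (R.aux + K * 4) R.rand) := fun j => R.sweep_workLinePass j 3
  have e₆ : (R.gates.map (NandGate.lift (K * 4))).flatMap encNand = R.gates.flatMap encNand := by
    simp only [List.flatMap_map, encNand_lift]
  have e₇ : ((R.reg.drop K).map (oldLine (K * 4))).flatMap encLine =
      encCLines (R.reg.drop K) := by
    simp only [List.flatMap_map, encLine_oldLine, encCLines]
  rw [encode_eq]
  simp only [sweep] at e₂ e₄
  simp only [sweep, unanimousPasses, List.flatMap_cons, List.flatMap_append, List.flatMap_assoc,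
    e₁, e₂, e₃, e₄, e₅, run_const]
  simp only [unanimous, encCLines, List.flatMap_append, List.flatMap_cons, e₆, e₇,
    encLine_oldLine, List.flatMap_map, List.flatMap_assoc, List.append_assoc, List.cons_append,
    List.nil_append, List.flatMap_nil, List.append_nil]

end RandCircuit

theorem uniform_unanimous {K : ℕ} (hK : 0 < K) {R : List Bool → RandCircuit}
    (hR : ∀ w, K ≤ (R w).reg.length) (hu : Uniform RandCircuit.encode R) :
    Uniform RandCircuit.encode fun w => (R w).unanimous hK (hR w) :=
  computableInPolyTime_sweep (unanimousPasses K) hu fun w => (R w).encode_unanimous hK (hR w)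

/-! ### The output distribution of parallel copies -/

variable {G : GateSet}

/-- Assignments of values to the lines of `K` copies. -/
def copiesEquiv (N K : ℕ) : (Fin (N * K) → Bool) ≃ (Fin K → Fin N → Bool) where
  toFun x j i := x (copyLine j i)
  invFun f l := f (finProdFinEquiv.symm l).2 (finProdFinEquiv.symm l).1
  left_inv x := by
    funext l
    exact congrArg x (finProdFinEquiv.apply_symm_apply l)
  right_inv f := by
    funext j i
    simp [copyLine]

theorem sum_prod_copies {N K : ℕ} {R : Type*} [CommSemiring R]
    (F : Fin K → (Fin N → Bool) → R) :
    ∑ x : Fin (N * K) → Bool, ∏ j, F j (fun i => x (copyLine j i)) = ∏ j, ∑ z, F j z := by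
  rw [Fintype.prod_sum]
  exact Fintype.sum_equiv (copiesEquiv N K) _ _ fun x => rfl

theorem hadamard_copies {N K : ℕ} (x z : Fin (N * K) → Bool) :
    hadamard (N * K) x z =
      ∏ j : Fin K, hadamard N (fun i => x (copyLine j i)) fun i => z (copyLine j i) := by
  simp only [hadamard]
  rw [Finset.prod_comm, ← Fintype.prod_prod_type']
  exact Fintype.prod_equiv finProdFinEquiv.symm _ _ fun l => by
    simp only [copyLine, Prod.mk.eta, Equiv.apply_symm_apply]

namespace IQPCircuit

/-- The diagonal entries of the product of the gates of a circuit. -/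
noncomputable def totalPhase (C : IQPCircuit G) (z : Fin C.lines → Bool) : ℂ :=
  (C.gates.map fun g => G.phase g.name fun j => z (g.on j)).prod

theorem prod_diag {N : ℕ} (L : List (PlacedGate G N)) :
    (L.map PlacedGate.diag).prod =
      Matrix.diagonal fun z => (L.map fun g => G.phase g.name fun j => z (g.on j)).prod := by
  induction L with
  | nil => simp [Matrix.diagonal_one]
  | cons g L ih =>
    rw [List.map_cons, List.prod_cons, ih, PlacedGate.diag, Matrix.diagonal_mul_diagonal]
    simp

theorem unitary_apply (C : IQPCircuit G) (x y : Fin C.lines → Bool) :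
    C.unitary x y = ∑ z, hadamard C.lines x z * C.totalPhase z * hadamard C.lines z y := by
  rw [unitary, prod_diag, Matrix.mul_apply]
  simp only [Matrix.mul_diagonal]
  rfl

theorem totalPhase_copies (K : ℕ) (C : IQPCircuit G) (z : Fin (C.lines * K) → Bool) :
    (C.copies K).totalPhase z = ∏ j : Fin K, C.totalPhase fun i => z (copyLine j i) := by
  have h : (C.copies K).totalPhase z = (((List.finRange K).flatMap fun j =>
    C.gates.map (PlacedGate.copy j)).map fun g => G.phase g.name fun j => z (g.on j)).prod := rfl
  rw [h, List.map_flatMap, List.flatMap_def, List.prod_flatten, List.map_map,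
    ← List.ofFn_eq_map, List.prod_ofFn]
  refine Finset.prod_congr rfl fun j _ => ?_
  rw [Function.comp_apply, List.map_map]
  rfl

/-- The two Hadamard layers and the phases are products of factors that each involve the lines of
one copy, so the sum over intermediate strings `z` factorizes and the amplitude is a product over
the copies. -/
theorem born_copies (K : ℕ) (C : IQPCircuit G) (x : Fin (C.lines * K) → Bool) :
    (C.copies K).born x = ∏ j : Fin K, C.born fun i => x (copyLine j i) := by
  have h : (C.copies K).unitary x (fun _ => false) =
      ∏ j : Fin K, C.unitary (fun i => x (copyLine j i)) fun _ => false := by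
    refine (unitary_apply (C.copies K) x fun _ => false).trans ?_
    simp only [unitary_apply C]
    rw [← sum_prod_copies]
    refine Finset.sum_congr rfl fun z _ => ?_
    rw [Finset.prod_mul_distrib, Finset.prod_mul_distrib]
    exact congr_arg₂ (· * ·) (congr_arg₂ (· * ·) (hadamard_copies x z) (totalPhase_copies K C z))
      (hadamard_copies z fun _ => false)
  have h' : (C.copies K).born x = ‖(C.copies K).unitary x (fun _ => false)‖ ^ 2 := rfl
  rw [h', h, norm_prod, ← Finset.prod_pow]
  rfl

theorem outProb_copies (K : ℕ) (C : IQPCircuit G) {o : Fin C.lines} {P : List (Fin C.lines)}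
    (hC : C.reg = o :: P) (b : Bool) :
    (C.copies K).outProb (List.replicate K b ++ List.replicate (K * P.length) false) =
      regProb C.born (o :: P) (b :: List.replicate P.length false) ^ K := by
  have hreg : (C.copies K).reg = (List.finRange K).map (fun j => copyLine j o) ++
      (List.finRange K).flatMap fun j => P.map (copyLine j) := by
    simp only [copies, hC, List.take_succ_cons, List.take_zero, List.drop_succ_cons, List.drop_zero,
      List.map_cons, List.map_nil]
    rw [← List.map_eq_flatMap]
  have hiff : ∀ x : Fin (C.lines * K) → Bool, (C.copies K).reg.map x =
        List.replicate K b ++ List.replicate (K * P.length) false ↔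
      ∀ j ∈ (Finset.univ : Finset (Fin K)), (o :: P).map (fun i => x (copyLine j i)) =
        b :: List.replicate P.length false := by
    intro x
    rw [hreg]
    have h : ((List.finRange K).map (fun j => copyLine j o) ++
        (List.finRange K).flatMap fun j => P.map (copyLine j)).map x =
        (List.finRange K).map (fun j => x (copyLine j o)) ++
        (List.finRange K).flatMap fun j => P.map fun i => x (copyLine j i) := by
      rw [List.map_append, List.map_map, List.map_flatMap]
      simp only [List.map_map]
      rfl
    refine (iff_of_eq (congrArg (· = _) h)).trans ?_
    rw [RandCircuit.append_eq_append_iff (by simp)]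
    simp only [List.eq_replicate_iff, List.length_map, List.length_finRange, List.mem_map,
      List.mem_finRange, true_and, forall_exists_index, forall_apply_eq_imp_iff,
      List.length_flatMap, List.mem_flatMap, List.map_const', List.sum_replicate, smul_eq_mul,
      List.map_cons, List.cons.injEq, Finset.mem_univ, forall_true_left]
    constructor
    · rintro ⟨h₁, h₂⟩ j
      exact ⟨h₁ j, fun b i hi => h₂ b j i hi⟩
    · intro h
      refine ⟨fun j => (h j).1, ?_⟩
      intro b j i hi
      exact (h j).2 b i hi
  have hsum : (C.copies K).outProb (List.replicate K b ++ List.replicate (K * P.length) false) =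
      ∑ x : Fin (C.lines * K) → Bool,
        if (C.copies K).reg.map x = List.replicate K b ++ List.replicate (K * P.length) false
        then (C.copies K).born x else 0 := rfl
  have hite : ∀ x : Fin (C.lines * K) → Bool,
      (if (C.copies K).reg.map x = List.replicate K b ++ List.replicate (K * P.length) false
        then (C.copies K).born x else 0) =
      ∏ j : Fin K, if (o :: P).map (fun i => x (copyLine j i)) =
          b :: List.replicate P.length false
        then C.born (fun i => x (copyLine j i)) else 0 := by
    intro x
    rw [Finset.prod_ite_zero]
    split_ifs with h₁ h₂ h₂
    · exact born_copies K C x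
    · exact absurd ((hiff x).1 h₁) h₂
    · exact absurd ((hiff x).2 h₂) h₁
    · rfl
  rw [hsum, Finset.sum_congr rfl fun x _ => hite x]
  rw [sum_prod_copies (fun _ z => if (o :: P).map z = b :: List.replicate P.length false
    then C.born z else 0)]
  simp [regProb]

theorem born_nonneg (C : IQPCircuit G) (x : Fin C.lines → Bool) : 0 ≤ C.born x := sq_nonneg _

end IQPCircuit

/-! ### Registers -/

section Registers

variable {ι : Type} [Fintype ι] [DecidableEq ι] {μ : (ι → Bool) → ℝ}

theorem regProb_nonneg (hμ : ∀ x, 0 ≤ μ x) (r : List ι) (y : List Bool) : 0 ≤ regProb μ r y :=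
  Finset.sum_nonneg fun x _ => by split_ifs; exacts [hμ x, le_rfl]

/-- Applied to a string of positive probability, this recovers the length of the simulator's
register from the simulation inequalities alone. -/
theorem length_eq_of_regProb_ne_zero {r : List ι} {y : List Bool} (h : regProb μ r y ≠ 0) :
    r.length = y.length := by
  obtain ⟨x, _, hx⟩ := Finset.exists_ne_zero_of_sum_ne_zero h
  rw [← (ite_ne_right_iff.1 hx).1, List.length_map]

theorem postProb_eq_add (μ : (ι → Bool) → ℝ) (o : ι) (P : List ι) :
    postProb μ P = regProb μ (o :: P) (false :: List.replicate P.length false) +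
      regProb μ (o :: P) (true :: List.replicate P.length false) := by
  simp only [postProb, regProb]
  rw [← Finset.sum_add_distrib]
  refine Finset.sum_congr rfl fun x _ => ?_
  simp only [List.map_cons, List.cons.injEq]
  cases x o <;> simp

end Registers

/-- Two-sided multiplicative error turns into a conditional error probability at most `1 / 3` when
the odds are small. -/
theorem two_thirds_le_div {c δ p q s t : ℝ} (hc : 1 ≤ c) (hδ : c ^ 2 * δ ≤ 1 / 2) (hs : 0 ≤ s)
    (hst : 0 < s + t) (hpq : q ≤ δ * p) (hp : 1 / c * p ≤ s) (hq : t ≤ c * q) (hδ0 : 0 ≤ δ) :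
    2 / 3 ≤ s / (s + t) := by
  have hc0 : 0 < c := by linarith
  have hp' : p ≤ c * s := by
    rw [one_div, inv_mul_le_iff₀ hc0] at hp
    exact hp
  have ht : t ≤ 1 / 2 * s :=
    calc t ≤ c * q := hq
      _ ≤ c * (δ * (c * s)) := by gcongr; exact hpq.trans (by gcongr)
      _ = c ^ 2 * δ * s := by ring
      _ ≤ 1 / 2 * s := by gcongr
  rw [le_div_iff₀ hst]
  linarith

/-- Passing from conditional probability to odds removes the normalization, so that taking `K`
copies simply raises the bound to the power `K`. -/
theorem odds_le {ε p q : ℝ} (hε : 0 < ε) (hε' : ε < 1 / 2) (hpq : 0 < p + q)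
    (h : 1 - ε ≤ p / (p + q)) : q ≤ ε / (1 - ε) * p := by
  rw [le_div_iff₀ hpq] at h
  have h1 : 0 < 1 - ε := by linarith
  rw [div_mul_eq_mul_div, le_div_iff₀ h1]
  nlinarith

end IQPSim

/-! ### Amplification, simulation and post-selection combined -/

theorem theorem2 (G : IQPSim.GateSet) (c : ℝ) (hc1 : 1 ≤ c) (hc2 : c < Real.sqrt 2)
    (hsim : ∀ C : List Bool → IQPSim.IQPCircuit G,
      IQPSim.Uniform IQPSim.IQPCircuit.encode C → IQPSim.WeaklySimulable c C) :
    IQPSim.PostIQP G ⊆ IQPSim.PostBPP := by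
  open IQPSim in
  rintro L ⟨ε, hε, hε', C, hC, hL⟩
  have hc0 : 0 < c := by linarith
  have h1ε : 0 < 1 - ε := by linarith
  -- Such `K` exists because `ε < 1 / 2` makes the base less than `1`; it depends only on `ε` and
  -- `c`.
  obtain ⟨K, hK⟩ : ∃ K : ℕ, (ε / (1 - ε)) ^ K < 1 / (2 * c ^ 2) :=
    exists_pow_lt_of_lt_one (by positivity) ((div_lt_one h1ε).2 (by linarith))
  have hδ : c ^ 2 * (ε / (1 - ε)) ^ K ≤ 1 / 2 := by
    calc c ^ 2 * (ε / (1 - ε)) ^ K ≤ c ^ 2 * (1 / (2 * c ^ 2)) := by gcongr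
      _ = 1 / 2 := by field_simp
  have hK0 : 0 < K := by
    -- For `K = 0` the bound would read `c ^ 2 ≤ 1 / 2`, against `1 ≤ c`.
    rcases Nat.eq_zero_or_pos K with rfl | h
    · rw [pow_zero] at hδ
      nlinarith
    · exact h
  obtain ⟨R, hR, hsimR⟩ := hsim _ (uniform_copies K hC)
  have key : ∀ w, ∃ n, (R w).reg.length = K + n ∧ ∃ p : Bool → ℝ,
      (∀ b, 0 ≤ p b) ∧ 0 < p false + p true ∧
      (∀ b, (1 / c * p b ^ K ≤ (R w).outProb (List.replicate K b ++ List.replicate n false) ∧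
        (R w).outProb (List.replicate K b ++ List.replicate n false) ≤ c * p b ^ K)) ∧
      (w ∈ L → p false ≤ ε / (1 - ε) * p true) ∧ (w ∉ L → p true ≤ ε / (1 - ε) * p false) := by
    intro w
    obtain ⟨o, P, hreg, hne, hyes, hno⟩ := hL w
    set p : Bool → ℝ := fun b =>
      regProb (C w).born (o :: P) (b :: List.replicate P.length false) with hp
    have hp0 : ∀ b, 0 ≤ p b := fun b => regProb_nonneg (C w).born_nonneg _ _
    have hpost : postProb (C w).born P = p false + p true := postProb_eq_add _ o P
    have hpos : 0 < p false + p true := by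
      rw [hpost] at hne
      exact lt_of_le_of_ne (add_nonneg (hp0 _) (hp0 _)) hne.symm
    have hs : ∀ b, (1 / c * p b ^ K ≤
          (R w).outProb (List.replicate K b ++ List.replicate (K * P.length) false) ∧
        (R w).outProb (List.replicate K b ++ List.replicate (K * P.length) false) ≤
          c * p b ^ K) := by
      intro b
      have := hsimR w (List.replicate K b ++ List.replicate (K * P.length) false)
      rwa [(C w).outProb_copies K hreg b] at this
    refine ⟨K * P.length, ?_, p, hp0, hpos, hs, fun hw => ?_, fun hw => ?_⟩
    · obtain ⟨b, hb⟩ : ∃ b, 0 < p b := by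
        by_contra! h
        linarith [h false, h true]
      have h0 : 0 < (R w).outProb (List.replicate K b ++ List.replicate (K * P.length) false) :=
        lt_of_lt_of_le (by positivity) (hs b).1
      have := length_eq_of_regProb_ne_zero h0.ne'
      simpa using this
    · have := hyes hw
      rw [condProb, hpost, add_comm] at this
      exact odds_le hε hε' (by linarith) this
    · have := hno hw
      rw [condProb, hpost] at this
      exact odds_le hε hε' hpos this
  have hRK : ∀ w, K ≤ (R w).reg.length := fun w => by
    obtain ⟨n, hn, -⟩ := key w
    omega
  refine ⟨1 / 3, by norm_num, by norm_num, fun w => (R w).unanimous hK0 (hRK w),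
    uniform_unanimous hK0 hRK hR, fun w => ?_⟩
  obtain ⟨n, hn, p, hp0, hpos, hs, hyes, hno⟩ := key w
  have hδ0 : 0 ≤ (ε / (1 - ε)) ^ K := by positivity
  set R' := (R w).unanimous hK0 (hRK w)
  obtain ⟨o, P, hreg⟩ : ∃ o P, R'.reg = o :: P := ⟨_, _, rfl⟩
  have hlen : P.length = K + n := by
    have : R'.reg.length = K + ((R w).reg.length - K) + 1 :=
      (R w).length_reg_unanimous hK0 (hRK w)
    rw [hreg, List.length_cons] at this
    omega
  have hprob : ∀ b, regProb R'.law (o :: P) (b :: List.replicate P.length false) =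
      (R w).outProb (List.replicate K b ++ List.replicate n false) := by
    intro b
    have := (R w).regProb_unanimous hK0 (hRK w) b
    rw [show (R w).reg.length - K = n by omega] at this
    rw [← this, hlen, ← hreg]
  set s : Bool → ℝ := fun b => (R w).outProb (List.replicate K b ++ List.replicate n false)
  have hpost : postProb R'.law P = s false + s true := by
    rw [postProb_eq_add _ o P, hprob, hprob]
  have hs0 : ∀ b, 0 ≤ s b := fun b =>
    le_trans (mul_nonneg (by positivity) (pow_nonneg (hp0 b) K)) (hs b).1
  -- The lower multiplicative bound keeps the classical post-selection event possible: some `p b` is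
  -- positive, hence so is `s b`.
  have hspos : 0 < s false + s true := by
    obtain ⟨b, hb⟩ : ∃ b, 0 < p b := by
      by_contra! h
      linarith [h false, h true]
    have h0 : 0 < s b := lt_of_lt_of_le (by positivity) (hs b).1
    cases b <;> linarith [hs0 false, hs0 true]
  refine ⟨o, P, hreg, hpost ▸ hspos.ne', fun hw => ?_, fun hw => ?_⟩
  · have h := pow_le_pow_left₀ (hp0 false) (hyes hw) K
    rw [mul_pow] at h
    rw [condProb, hprob, hpost, add_comm (s false)]
    have := two_thirds_le_div hc1 hδ (hs0 true) (by linarith) h (hs true).1 (hs false).2 hδ0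
    linarith
  · have h := pow_le_pow_left₀ (hp0 true) (hno hw) K
    rw [mul_pow] at h
    rw [condProb, hprob, hpost]
    have := two_thirds_le_div hc1 hδ (hs0 false) hspos h (hs false).1 (hs true).2 hδ0
    linarith
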